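/- **Theorem 3 (Stability of LS-CS with add-LS-del).** *Notation.* Let $A$ be a real $n\times m$ matrix with $n<m$, and $A_0$ a real $n_0\times m$ matrix; $A_T$ is the submatrix of the columns of $A$ indexed by $T\subseteq\{1,\dots,m\}$, $A_T^\dagger$ is its Moore–Penrose pseudo-inverse, and $\|\cdot\|$ is the Euclidean norm. $\delta_S=\delta_S(A)$ is the smallest $\delta\ge 0$ with $(1-\delta)\|c\|^2\le\|A_Tc\|^2\le(1+\delta)\|c\|^2$ for all $|T|\le S$ and all $c$; $\theta_{S,S'}=\theta_{S,S'}(A)$ is the smallest $\theta\ge0$ with $|\langle A_Tc,A_{T'}c'\rangle|\le\theta\|c\|\|c'\|$ for all disjoint $T,T'$ with $|T|\le S$, $|T'|\le S'$ and all $c,c'$. Put $$C_1(S)=\frac{4\sqrt{1+\delta_S}}{1-(\sqrt2+1)\delta_S},\quad C_2(S)=2\,\frac{1+(\sqrt2-1)\delta_S}{1-(\sqrt2+1)\delta_S},$$ $$C'(a,k)=C_1(2k)+\sqrt2\,C_2(2k)\sqrt{a/k},\qquad C''(a,k)=2\,C_2(2k)\sqrt a .$$ *Signal model.* Let $S_a\ge1$,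 $d\ge2$ and $S_0$ be integers, $r>0$. The signals $x_t\in\mathbb R^m$, $t=0,1,2,\dots$, have supports $N_t$. The set $N_0$ has $S_0$ elements: $2S_a$ of each of the magnitudes $r,2r,\dots,(d-1)r$, and $S_0-(2d-2)S_a$ of magnitude $dr$. At each $t>0$, for every $0\le j\le d-1$, exactly $S_a$ coefficients change their magnitude from $jr$ to $(j+1)r$, and exactly $S_a$ from $(j+1)r$ to $jr$; all other magnitudes are unchanged. (For $j=0$ these are additions to and removals from the support.) *Observations.* $y_0=A_0x_0+w_0$ and $y_t=Ax_t+w_t$ for $t\ge1$, with $\|w_t\|\le\epsilon$ for all $t\ge 0$. *Algorithm.* The LS estimate on $T$ is the vector $z$ with $z_T=A_T^\dagger y_t$ and $z_{T^c}=0$ (with $A_0$ in place of $A$ at $t=0$). At $t=0$ let $T_0=\emptyset$ and let $\hat x_{0,\mathrm{CSres}}$ be a minimizer of $\|\beta\|_1$ subject to $\|y_0-A_0\beta\|\le\epsilon$. At $t\ge1$ let $T_t=\tilde T_{t-1}$, let $\hat x_{t,\mathrm{init}}$ be the LS estimate on $T_t$, let $\hat\beta_t$ be a minimizer of $\|\beta\|_1$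 subject to $\|(y_t-A\hat x_{t,\mathrm{init}})-A\beta\|\le\epsilon$, and let $\hat x_{t,\mathrm{CSres}}=\hat\beta_t+\hat x_{t,\mathrm{init}}$. At every $t\ge0$ let $T_{\mathrm{add},t}=T_t\cup\{i\notin T_t:|(\hat x_{t,\mathrm{CSres}})_i|>\alpha_{add}\}$, let $\hat x_{t,\mathrm{add}}$ be the LS estimate on $T_{\mathrm{add},t}$, let $\tilde T_t=T_{\mathrm{add},t}\setminus\{i\in T_{\mathrm{add},t}:|(\hat x_{t,\mathrm{add}})_i|\le\alpha_{del}\}$, and let $\hat x_t$ be the LS estimate on $\tilde T_t$. *Assumptions.* 1. (thresholds) At each $t\ge 0$ there are at most $S_a$ false additions, i.e. $|(T_{\mathrm{add},t}\setminus T_t)\setminus N_t|\le S_a$; and $\alpha_{del}=\sqrt2\,\epsilon+2\sqrt{S_a}\,\theta_{S_0+2S_a,S_a}\,r$. 2. $\delta_{4S_a}<(\sqrt2-1)/2$, $\ \delta_{S_0+2S_a}<1/2$, $\ \theta_{S_0,2S_a}C''(S_0,2S_a)<\dfrac1{(2+\sqrt2)\sqrt{S_a}}$, $\ \theta_{S_0+2S_a,S_a}<\dfrac12\sqrt{\dfrac1{4S_a}}$.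 3. $r\ge\max(\tilde G_1,\tilde G_2)$, where $$\tilde G_1=\max_{1\le k\le 2S_a}\frac{\alpha_{add}+C'(S_0,k)\epsilon}{2-(2+\sqrt2)\,\theta_{S_0,k}\sqrt{S_a}\,C''(S_0,k)},\qquad \tilde G_2=\frac{\sqrt2\,\epsilon}{1-\theta_{S_0+2S_a,S_a}\sqrt{4S_a}} .$$ 4. (initial time) $N_0\setminus\tilde T_0\subseteq\{i:0<|x_{0,i}|<2r\}$, $|N_0\setminus\tilde T_0|\le2S_a$, $|\tilde T_0\setminus N_0|=0$, $|\tilde T_0|\le S_0$. *Conclusions.* 1. For all $t\ge0$: $|\tilde T_t|\le S_0$, $|\tilde T_t\setminus N_t|=0$, $|N_t\setminus\tilde T_t|\le2S_a$. 2. $|T_t|\le S_0$ and $|T_t\setminus N_t|\le S_a$ for all $t\ge0$, and $|N_t\setminus T_t|\le2S_a$ for all $t\ge1$. 3. $|T_{\mathrm{add},t}|\le S_0+2S_a$ and $|T_{\mathrm{add},t}\setminus N_t|\le2S_a$ for all $t\ge0$, and $|N_t\setminus T_{\mathrm{add},t}|\le S_a$ for all $t\ge1$. 4. For all $t\ge1$: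 $\|x_t-\hat x_t\|\le\sqrt2\,\epsilon+(2\theta_{S_0,2S_a}+1)\sqrt{2S_a}\,r$. At $t=0$ the same bound holds with $\theta_{S_0,2S_a}(A_0)$ in place of $\theta_{S_0,2S_a}(A)$, provided that $\delta_{S_0}(A_0)<1/2$. 5. For all $t\ge1$: $\|x_t-\hat x_{t,\mathrm{CSres}}\|\le\max_{1\le k\le2S_a}\bigl[C'(S_0,k)\epsilon+(\theta_{S_0,k}C''(S_0,k)+1)\sqrt{2S_a}\,r\bigr]$. -/

import Mathlib

open scoped Matrix

noncomputable section

/-! ## Norms and the support of a vector -/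

/-- The Euclidean norm of a vector of reals. -/
def l2norm {ι : Type*} [Fintype ι] (v : ι → ℝ) : ℝ :=
  ‖(WithLp.toLp 2 v : EuclideanSpace ℝ ι)‖

/-- The `ℓ₁` norm of a vector of reals. -/
def l1norm {ι : Type*} [Fintype ι] (v : ι → ℝ) : ℝ :=
  ∑ i, |v i|

open Classical in
/-- The set of indices of the nonzero entries of a vector. -/
def supp {m : ℕ} (x : Fin m → ℝ) : Finset (Fin m) :=
  Finset.univ.filter fun i => x i ≠ 0

/-! ## Restricted isometry and restricted orthogonality constants -/

/-- The `S`-restricted isometry constant `δ_S` of `A`: the smallest `δ ≥ 0` such that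
`(1 - δ) ‖c‖² ≤ ‖A_T c‖² ≤ (1 + δ) ‖c‖²` for all index sets `T` with `|T| ≤ S` and all
coefficient vectors `c` on `T` (here extended by zero outside `T`). -/
def ric {n m : ℕ} (A : Matrix (Fin n) (Fin m) ℝ) (S : ℕ) : ℝ :=
  sInf {δ : ℝ | 0 ≤ δ ∧ ∀ T : Finset (Fin m), T.card ≤ S →
    ∀ c : Fin m → ℝ, (∀ i, i ∉ T → c i = 0) →
      (1 - δ) * l2norm c ^ 2 ≤ l2norm (A *ᵥ c) ^ 2 ∧
      l2norm (A *ᵥ c) ^ 2 ≤ (1 + δ) * l2norm c ^ 2}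

/-- The `S,S'`-restricted orthogonality constant `θ_{S,S'}` of `A`: the smallest `θ ≥ 0` such that
`|⟨A_T c, A_{T'} c'⟩| ≤ θ ‖c‖ ‖c'‖` for all disjoint `T, T'` with `|T| ≤ S`, `|T'| ≤ S'` and all
coefficient vectors `c` on `T`, `c'` on `T'` (extended by zero). -/
def roc {n m : ℕ} (A : Matrix (Fin n) (Fin m) ℝ) (S S' : ℕ) : ℝ :=
  sInf {θ : ℝ | 0 ≤ θ ∧ ∀ T T' : Finset (Fin m), Disjoint T T' → T.card ≤ S → T'.card ≤ S' →
    ∀ c c' : Fin m → ℝ, (∀ i, i ∉ T → c i = 0) → (∀ i, i ∉ T' → c' i = 0) →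
      |(A *ᵥ c) ⬝ᵥ (A *ᵥ c')| ≤ θ * (l2norm c * l2norm c')}

/-! ## The constants of the error bounds -/

/-- `C₁(S) = 4 √(1 + δ_S) / (1 - (√2 + 1) δ_S)`. -/
def constC1 {n m : ℕ} (A : Matrix (Fin n) (Fin m) ℝ) (S : ℕ) : ℝ :=
  4 * √(1 + ric A S) / (1 - (√2 + 1) * ric A S)

/-- `C₂(S) = 2 (1 + (√2 - 1) δ_S) / (1 - (√2 + 1) δ_S)`. -/
def constC2 {n m : ℕ} (A : Matrix (Fin n) (Fin m) ℝ) (S : ℕ) : ℝ :=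
  2 * ((1 + (√2 - 1) * ric A S) / (1 - (√2 + 1) * ric A S))

/-- `C'(a, k) = C₁(2k) + √2 C₂(2k) √(a/k)`; meaningful for `k ≥ 1`. -/
def constC' {n m : ℕ} (A : Matrix (Fin n) (Fin m) ℝ) (a k : ℕ) : ℝ :=
  constC1 A (2 * k) + √2 * constC2 A (2 * k) * √((a : ℝ) / (k : ℝ))

/-- `C''(a, k) = 2 C₂(2k) √a`. -/
def constC'' {n m : ℕ} (A : Matrix (Fin n) (Fin m) ℝ) (a k : ℕ) : ℝ :=
  2 * constC2 A (2 * k) * √(a : ℝ)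

/-- The maximum of `f k` over the cardinalities `1 ≤ k ≤ 2 Sₐ`. -/
def maxCard (Sa : ℕ) (hSa : 1 ≤ Sa) (f : ℕ → ℝ) : ℝ :=
  (Finset.Icc 1 (2 * Sa)).sup' (Finset.nonempty_Icc.mpr (by omega)) f

/-- `G̃₁`, the first lower bound on the rate of increase of the coefficients. -/
def rateG1 {n m : ℕ} (A : Matrix (Fin n) (Fin m) ℝ) (S0 Sa : ℕ) (hSa : 1 ≤ Sa)
    (ε αadd : ℝ) : ℝ :=
  maxCard Sa hSa fun k =>
    (αadd + constC' A S0 k * ε) /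
      (2 - (2 + √2) * roc A S0 k * √(Sa : ℝ) * constC'' A S0 k)

/-- `G̃₂`, the second lower bound on the rate of increase of the coefficients. -/
def rateG2 {n m : ℕ} (A : Matrix (Fin n) (Fin m) ℝ) (S0 Sa : ℕ) (ε : ℝ) : ℝ :=
  √2 * ε / (1 - roc A (S0 + 2 * Sa) Sa * √(4 * (Sa : ℝ)))

/-! ## The signal model -/

open Classical in
/-- The indices whose magnitude is `a` in `x` and `b` in `x'`. -/
def moves {m : ℕ} (x x' : Fin m → ℝ) (a b : ℝ) : Finset (Fin m) :=
  Finset.univ.filter fun i => |x i| = a ∧ |x' i| = b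

open Classical in
/-- The indices at which `x` has magnitude `a`. -/
def level {m : ℕ} (x : Fin m → ℝ) (a : ℝ) : Finset (Fin m) :=
  Finset.univ.filter fun i => |x i| = a

open Classical in
/-- The small nonzero elements `{i : 0 < |x_i| < b}`. -/
def small {m : ℕ} (x : Fin m → ℝ) (b : ℝ) : Finset (Fin m) :=
  Finset.univ.filter fun i => 0 < |x i| ∧ |x i| < b

/-- The signal model with initial support size `S0`, support change size `Sa`, rate `r` and
number of magnitude levels `d` (the maximum magnitude is `d r`). -/
structure SignalModel {m : ℕ} (x : ℕ → Fin m → ℝ) (S0 Sa d : ℕ) (r : ℝ) : Prop where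
  /-- Addition (`j = 0`) and increase (`1 ≤ j ≤ d - 1`): at each time exactly `Sa` coefficients of
  magnitude `j r` get magnitude `(j + 1) r`. -/
  increase : ∀ t j : ℕ, j < d →
    (moves (x t) (x (t + 1)) ((j : ℝ) * r) (((j : ℝ) + 1) * r)).card = Sa
  /-- Removal (`j = 0`) and decrease (`1 ≤ j ≤ d - 1`): at each time exactly `Sa` coefficients of
  magnitude `(j + 1) r` get magnitude `j r`. -/
  decrease : ∀ t j : ℕ, j < d →
    (moves (x t) (x (t + 1)) (((j : ℝ) + 1) * r) ((j : ℝ) * r)).card = Sa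
  /-- There are no changes of magnitude but these. -/
  unchanged : ∀ (t : ℕ) (i : Fin m),
    |x (t + 1) i| = |x t i| ∨
    ∃ j : ℕ, j < d ∧
      (i ∈ moves (x t) (x (t + 1)) ((j : ℝ) * r) (((j : ℝ) + 1) * r) ∨
       i ∈ moves (x t) (x (t + 1)) (((j : ℝ) + 1) * r) ((j : ℝ) * r))
  /-- The initial support has `S0` elements. -/
  init_card : (supp (x 0)).card = S0
  /-- It has `2 Sa` elements of each of the magnitudes `r, 2r, …, (d - 1) r`. -/
  init_small : ∀ j : ℕ, 1 ≤ j → j < d → (level (x 0) ((j : ℝ) * r)).card = 2 * Sa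
  /-- The other `S0 - (2d - 2) Sa` elements have magnitude `d r`. -/
  init_large : (level (x 0) ((d : ℝ) * r)).card + (2 * d - 2) * Sa = S0

/-! ## LS-CS with add-LS-del -/

/-- `P` is the Moore–Penrose pseudo-inverse of `M`. -/
structure IsPinv {ι κ : Type*} [Fintype ι] [Fintype κ]
    (M : Matrix ι κ ℝ) (P : Matrix κ ι ℝ) : Prop where
  mul_mul : M * P * M = M
  mul_mul' : P * M * P = P
  symm_left : (M * P)ᵀ = M * P
  symm_right : (P * M)ᵀ = P * M

/-- The submatrix `A_T` of the columns of `A` with index in `T`. -/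
def colSub {n m : ℕ} (A : Matrix (Fin n) (Fin m) ℝ) (T : Finset (Fin m)) :
    Matrix (Fin n) {i // i ∈ T} ℝ :=
  A.submatrix id Subtype.val

/-- `z` is the least squares estimate on `T`: `z_T = A_T† y` and `z` vanishes outside `T`. -/
def IsLSEstimate {n m : ℕ} (A : Matrix (Fin n) (Fin m) ℝ) (T : Finset (Fin m))
    (y : Fin n → ℝ) (z : Fin m → ℝ) : Prop :=
  (∃ P : Matrix {i // i ∈ T} (Fin n) ℝ, IsPinv (colSub A T) P ∧
    ∀ i : {i // i ∈ T}, z i = (P *ᵥ y) i) ∧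
  ∀ i, i ∉ T → z i = 0

/-- `β` is a solution of `min ‖β‖₁` subject to `‖y - A β‖ ≤ ε`. -/
def IsCSSolution {n m : ℕ} (A : Matrix (Fin n) (Fin m) ℝ) (ε : ℝ)
    (y : Fin n → ℝ) (β : Fin m → ℝ) : Prop :=
  l2norm (y - A *ᵥ β) ≤ ε ∧
  ∀ β' : Fin m → ℝ, l2norm (y - A *ᵥ β') ≤ ε → l1norm β ≤ l1norm β'

/-- `z` is an output of the CS-residual step with known support part `T`: the initial least
squares estimate on `T` plus a solution of CS on its residual. -/
def IsCSResidual {n m : ℕ} (A : Matrix (Fin n) (Fin m) ℝ) (ε : ℝ) (T : Finset (Fin m))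
    (y : Fin n → ℝ) (z : Fin m → ℝ) : Prop :=
  ∃ xinit β : Fin m → ℝ, IsLSEstimate A T y xinit ∧
    IsCSSolution A ε (y - A *ᵥ xinit) β ∧ z = β + xinit

/-- The quantities computed by the algorithm at one time. -/
structure LSCSState (m : ℕ) where
  /-- `T_t`, the support estimate of the previous time. -/
  T : Finset (Fin m)
  /-- `x̂_{t,CSres}`, the output of the CS step. -/
  xCSres : Fin m → ℝ
  /-- `T_{add,t}`, the set obtained after the addition step. -/
  Tadd : Finset (Fin m)
  /-- `x̂_{t,add}`, the least squares estimate on `T_{add,t}`. -/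
  xadd : Fin m → ℝ
  /-- `T̃_t = N̂_t`, the final support estimate. -/
  Tfin : Finset (Fin m)
  /-- `x̂_t`, the final estimate. -/
  xhat : Fin m → ℝ

open Classical in
/-- The addition, least squares and deletion steps at one time. -/
structure IsAddLSDel {n m : ℕ} (A : Matrix (Fin n) (Fin m) ℝ) (αadd αdel : ℝ)
    (y : Fin n → ℝ) (s : LSCSState m) : Prop where
  add : s.Tadd = s.T ∪ Finset.univ.filter (fun i => i ∉ s.T ∧ αadd < |s.xCSres i|)
  add_ls : IsLSEstimate A s.Tadd y s.xadd
  del : s.Tfin = s.Tadd \ s.Tadd.filter (fun i => |s.xadd i| ≤ αdel)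
  del_ls : IsLSEstimate A s.Tfin y s.xhat

/-- `s` is a run of LS-CS with add-LS-del, with the matrix `A₀` and the measurement `y₀` at time
`0`, and the matrix `A` and the measurement `y t` at time `t ≥ 1`. -/
structure IsLSCSRun {n₀ n m : ℕ} (A₀ : Matrix (Fin n₀) (Fin m) ℝ)
    (A : Matrix (Fin n) (Fin m) ℝ) (ε αadd αdel : ℝ) (y₀ : Fin n₀ → ℝ) (y : ℕ → Fin n → ℝ)
    (s : ℕ → LSCSState m) : Prop where
  init_T : (s 0).T = ∅
  init_cs : IsCSSolution A₀ ε y₀ (s 0).xCSres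
  init_addLSDel : IsAddLSDel A₀ αadd αdel y₀ (s 0)
  step_T : ∀ t, (s (t + 1)).T = (s t).Tfin
  step_csres : ∀ t, IsCSResidual A ε (s (t + 1)).T (y (t + 1)) (s (t + 1)).xCSres
  step_addLSDel : ∀ t, IsAddLSDel A αadd αdel (y (t + 1)) (s (t + 1))

end

/-! ## The Euclidean norm of a vector of reals -/

/-! The proof is an induction on time with the invariant that the final support estimate is
contained in the true support and that every missed entry has magnitude exactly `r`.

The combinatorial half comes from the signal model. All magnitudes are multiples of `r`, the support
always has `S0` elements, and the level `r` always has `2 * Sa` elements, all of which leave it at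
the next step, half to `0` and half to `2 * r` (`SignalModel.card_level`,
`SignalModel.level_subset_moves`). So an entry missed at time `t` either disappears or grows to `2 *
r`. At time `t + 1` the inherited set therefore misses at most `2 * Sa` entries, the new ones of
magnitude `r` and the grown ones of magnitude `2 * r`, and it contains at most `Sa` removed indices.

The analytic half bounds two errors. For least squares, the residual is orthogonal to the chosen
columns, so the error on the chosen set is governed by the noise and by the restricted correlation
with the missed entries (`IsLSEstimate.error_on_support`). For the CS step, the unknown is the
residual signal, whose part off the missed set is just that least squares error; stability of `ℓ₁`
minimization (`l1_error_le`) then applies (`IsCSResidual.error_le`).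

The two halves meet in `SignalModel.lscs_step`. The bound `rateG1` makes every entry of magnitude at
least `2 * r` detectable, so after addition only new entries of magnitude `r` are missing. The least
squares error on the enlarged set is then below `αdel`, so deletion removes every false index;
`rateG2` gives `αdel ≤ r`, so it spares every entry of magnitude at least `2 * r`. This restores the
invariant. -/

theorem l2norm_nonneg {ι : Type*} [Fintype ι] (v : ι → ℝ) : 0 ≤ l2norm v :=
  norm_nonneg _

theorem l2norm_sq {ι : Type*} [Fintype ι] (v : ι → ℝ) : l2norm v ^ 2 = v ⬝ᵥ v := by
  unfold l2norm
  rw [EuclideanSpace.real_norm_sq_eq]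
  simp [dotProduct, sq]

theorem l2norm_sq_eq_sum {ι : Type*} [Fintype ι] (v : ι → ℝ) :
    l2norm v ^ 2 = ∑ i, v i ^ 2 := by
  rw [l2norm_sq]; simp [dotProduct, sq]

theorem l2norm_add_le {ι : Type*} [Fintype ι] (u v : ι → ℝ) :
    l2norm (u + v) ≤ l2norm u + l2norm v := by
  unfold l2norm; rw [WithLp.toLp_add]; exact norm_add_le _ _

theorem l2norm_sub_le {ι : Type*} [Fintype ι] (u v : ι → ℝ) :
    l2norm (u - v) ≤ l2norm u + l2norm v := by
  unfold l2norm; rw [WithLp.toLp_sub]; exact norm_sub_le _ _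

theorem l2norm_sub_comm {ι : Type*} [Fintype ι] (u v : ι → ℝ) :
    l2norm (u - v) = l2norm (v - u) := by
  unfold l2norm; rw [WithLp.toLp_sub, WithLp.toLp_sub]; exact norm_sub_rev _ _

theorem l2norm_smul {ι : Type*} [Fintype ι] (a : ℝ) (v : ι → ℝ) :
    l2norm (a • v) = |a| * l2norm v := by
  unfold l2norm; rw [WithLp.toLp_smul, norm_smul]; rfl

theorem l2norm_zero {ι : Type*} [Fintype ι] : l2norm (0 : ι → ℝ) = 0 := by
  unfold l2norm; simp

theorem l2norm_eq_zero {ι : Type*} [Fintype ι] {v : ι → ℝ} (h : l2norm v = 0) : v = 0 := by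
  unfold l2norm at h
  rw [norm_eq_zero] at h
  simpa using h

theorem abs_dotProduct_le {ι : Type*} [Fintype ι] (u v : ι → ℝ) :
    |u ⬝ᵥ v| ≤ l2norm u * l2norm v := by
  apply abs_le_of_sq_le_sq _ (mul_nonneg (l2norm_nonneg u) (l2norm_nonneg v))
  rw [mul_pow, l2norm_sq_eq_sum, l2norm_sq_eq_sum]
  exact Finset.sum_mul_sq_le_sq_mul_sq _ _ _

theorem abs_apply_le_l2norm {ι : Type*} [Fintype ι] (v : ι → ℝ) (i : ι) : |v i| ≤ l2norm v := by
  apply abs_le_of_sq_le_sq _ (l2norm_nonneg v)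
  rw [l2norm_sq_eq_sum]
  exact Finset.single_le_sum (f := fun i => v i ^ 2) (fun i _ => sq_nonneg _) (Finset.mem_univ i)

/-! ## Restriction of a vector to an index set -/

/-- The vector `v_T`, extended by zero outside `T`. -/
def restrictTo {m : ℕ} (T : Finset (Fin m)) (v : Fin m → ℝ) : Fin m → ℝ :=
  fun i => if i ∈ T then v i else 0

theorem restrictTo_of_mem {m : ℕ} {T : Finset (Fin m)} (v : Fin m → ℝ) {i : Fin m} (h : i ∈ T) :
    restrictTo T v i = v i := if_pos h

theorem restrictTo_of_notMem {m : ℕ} {T : Finset (Fin m)} (v : Fin m → ℝ) {i : Fin m}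
    (h : i ∉ T) : restrictTo T v i = 0 := if_neg h

theorem restrictTo_union {m : ℕ} {T U : Finset (Fin m)} (h : Disjoint T U) (v : Fin m → ℝ) :
    restrictTo (T ∪ U) v = restrictTo T v + restrictTo U v := by
  funext i
  simp only [restrictTo, Finset.mem_union, Pi.add_apply]
  by_cases h1 : i ∈ T
  · simp [h1, Finset.disjoint_left.1 h h1]
  · simp [h1]

theorem restrictTo_add_sdiff {m : ℕ} {T U : Finset (Fin m)} (h : T ⊆ U) (v : Fin m → ℝ) :
    restrictTo T v + restrictTo (U \ T) v = restrictTo U v := by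
  rw [← restrictTo_union Finset.disjoint_sdiff, Finset.union_sdiff_of_subset h]

theorem restrictTo_add_compl {m : ℕ} (T : Finset (Fin m)) (v : Fin m → ℝ) :
    restrictTo T v + restrictTo Tᶜ v = v := by
  funext i
  simp only [restrictTo, Finset.mem_compl, Pi.add_apply]
  by_cases h1 : i ∈ T <;> simp [h1]

theorem restrictTo_empty {m : ℕ} (v : Fin m → ℝ) : restrictTo ∅ v = 0 := by
  funext i; simp [restrictTo]

theorem l2norm_restrictTo_sq {m : ℕ} (T : Finset (Fin m)) (v : Fin m → ℝ) :
    l2norm (restrictTo T v) ^ 2 = ∑ i ∈ T, v i ^ 2 := by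
  rw [l2norm_sq_eq_sum]
  simp [restrictTo, Finset.sum_ite_mem]

theorem l2norm_restrictTo_mono {m : ℕ} {T U : Finset (Fin m)} (h : T ⊆ U) (v : Fin m → ℝ) :
    l2norm (restrictTo T v) ≤ l2norm (restrictTo U v) := by
  apply le_of_sq_le_sq _ (l2norm_nonneg _)
  rw [l2norm_restrictTo_sq, l2norm_restrictTo_sq]
  exact Finset.sum_le_sum_of_subset_of_nonneg h fun i _ _ => sq_nonneg _

theorem l2norm_restrictTo_le {m : ℕ} {T : Finset (Fin m)} {v : Fin m → ℝ} {M : ℝ} (hM : 0 ≤ M)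
    {k : ℕ} (hk : T.card ≤ k) (h : ∀ i ∈ T, |v i| ≤ M) :
    l2norm (restrictTo T v) ≤ √k * M := by
  apply le_of_sq_le_sq _ (by positivity)
  rw [l2norm_restrictTo_sq, mul_pow, Real.sq_sqrt (Nat.cast_nonneg k)]
  calc ∑ i ∈ T, v i ^ 2 ≤ ∑ i ∈ T, M ^ 2 :=
        Finset.sum_le_sum fun i hi => sq_le_sq.2 (by rw [abs_of_nonneg hM]; exact h i hi)
    _ = T.card * M ^ 2 := by simp
    _ ≤ k * M ^ 2 := by gcongr

theorem sum_abs_le_sqrt_mul_l2norm {m : ℕ} {T : Finset (Fin m)} {k : ℕ} (hk : T.card ≤ k)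
    (v : Fin m → ℝ) : ∑ i ∈ T, |v i| ≤ √k * l2norm (restrictTo T v) := by
  apply le_of_sq_le_sq _ (mul_nonneg (Real.sqrt_nonneg _) (l2norm_nonneg _))
  rw [mul_pow, l2norm_restrictTo_sq, Real.sq_sqrt (Nat.cast_nonneg k)]
  have h := sq_sum_le_card_mul_sum_sq (s := T) (f := fun i => |v i|)
  simp only [sq_abs] at h
  refine h.trans ?_
  have : 0 ≤ ∑ i ∈ T, v i ^ 2 := Finset.sum_nonneg fun i _ => sq_nonneg _
  gcongr

theorem l2norm_add_sq_of_disjoint {m : ℕ} {T U : Finset (Fin m)} (h : Disjoint T U)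
    {u v : Fin m → ℝ} (hu : ∀ i, i ∉ T → u i = 0) (hv : ∀ i, i ∉ U → v i = 0) :
    l2norm (u + v) ^ 2 = l2norm u ^ 2 + l2norm v ^ 2 := by
  simp only [l2norm_sq_eq_sum, ← Finset.sum_add_distrib]
  refine Finset.sum_congr rfl fun i _ => ?_
  by_cases h1 : i ∈ T
  · simp [hv i (Finset.disjoint_left.1 h h1)]
  · simp [hu i h1]

/-! ## Restricted isometry and orthogonality constants -/

theorem exists_l2norm_mulVec_le {n m : ℕ} (A : Matrix (Fin n) (Fin m) ℝ) :
    ∃ M, 0 ≤ M ∧ ∀ c, l2norm (A *ᵥ c) ≤ M * l2norm c := by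
  refine ⟨‖(Matrix.toLpLin 2 2 A).toContinuousLinearMap‖, norm_nonneg _, fun c => ?_⟩
  exact (Matrix.toLpLin 2 2 A).toContinuousLinearMap.le_opNorm (WithLp.toLp 2 c)

theorem ric_set_nonempty {n m : ℕ} (A : Matrix (Fin n) (Fin m) ℝ) (S : ℕ) :
    {δ : ℝ | 0 ≤ δ ∧ ∀ T : Finset (Fin m), T.card ≤ S →
    ∀ c : Fin m → ℝ, (∀ i, i ∉ T → c i = 0) →
      (1 - δ) * l2norm c ^ 2 ≤ l2norm (A *ᵥ c) ^ 2 ∧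
      l2norm (A *ᵥ c) ^ 2 ≤ (1 + δ) * l2norm c ^ 2}.Nonempty := by
  obtain ⟨M, hM, h⟩ := exists_l2norm_mulVec_le A
  refine ⟨1 + M ^ 2, by positivity, fun T _ c _ => ⟨?_, ?_⟩⟩
  · have := mul_nonneg (sq_nonneg M) (sq_nonneg (l2norm c))
    nlinarith [sq_nonneg (l2norm (A *ᵥ c))]
  · have := pow_le_pow_left₀ (l2norm_nonneg _) (h c) 2
    nlinarith [sq_nonneg (l2norm c)]

theorem ric_nonneg {n m : ℕ} (A : Matrix (Fin n) (Fin m) ℝ) (S : ℕ) : 0 ≤ ric A S :=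
  le_csInf (ric_set_nonempty A S) fun _ h => h.1

/-- An inequality affine in `δ` with slope `b ≥ 0` passes to the infimum. This is why the infima
defining `ric` and `roc` themselves satisfy the inequalities that define them. -/
theorem le_add_csInf_mul {s : Set ℝ} (hs : s.Nonempty) {a b c : ℝ} (hb : 0 ≤ b)
    (h : ∀ δ ∈ s, a ≤ c + δ * b) : a ≤ c + sInf s * b := by
  rcases hb.eq_or_lt with rfl | hb
  · obtain ⟨δ, hδ⟩ := hs
    simpa using h δ hδ
  · have : (a - c) / b ≤ sInf s := le_csInf hs fun δ hδ => by
      rw [div_le_iff₀ hb]; linarith [h δ hδ]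
    rw [div_le_iff₀ hb] at this
    linarith

theorem ric_lower {n m : ℕ} (A : Matrix (Fin n) (Fin m) ℝ) {S : ℕ} {T : Finset (Fin m)}
    (hT : T.card ≤ S) {c : Fin m → ℝ} (hc : ∀ i, i ∉ T → c i = 0) :
    (1 - ric A S) * l2norm c ^ 2 ≤ l2norm (A *ᵥ c) ^ 2 := by
  have := le_add_csInf_mul (ric_set_nonempty A S) (sq_nonneg (l2norm c))
    (a := l2norm c ^ 2) (c := l2norm (A *ᵥ c) ^ 2)
    fun δ hδ => by linarith [(hδ.2 T hT c hc).1]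
  unfold ric
  linarith

theorem ric_upper {n m : ℕ} (A : Matrix (Fin n) (Fin m) ℝ) {S : ℕ} {T : Finset (Fin m)}
    (hT : T.card ≤ S) {c : Fin m → ℝ} (hc : ∀ i, i ∉ T → c i = 0) :
    l2norm (A *ᵥ c) ^ 2 ≤ (1 + ric A S) * l2norm c ^ 2 := by
  have := le_add_csInf_mul (ric_set_nonempty A S) (sq_nonneg (l2norm c))
    (a := l2norm (A *ᵥ c) ^ 2) (c := l2norm c ^ 2)
    fun δ hδ => by linarith [(hδ.2 T hT c hc).2]
  unfold ric
  linarith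

theorem ric_mono {n m : ℕ} (A : Matrix (Fin n) (Fin m) ℝ) {S S' : ℕ} (h : S ≤ S') :
    ric A S ≤ ric A S' :=
  csInf_le_csInf ⟨0, fun _ h => h.1⟩ (ric_set_nonempty A S') fun _ hδ =>
    ⟨hδ.1, fun T hT => hδ.2 T (hT.trans h)⟩

theorem roc_set_nonempty {n m : ℕ} (A : Matrix (Fin n) (Fin m) ℝ) (S S' : ℕ) :
    {θ : ℝ | 0 ≤ θ ∧ ∀ T T' : Finset (Fin m), Disjoint T T' → T.card ≤ S → T'.card ≤ S' →
    ∀ c c' : Fin m → ℝ, (∀ i, i ∉ T → c i = 0) → (∀ i, i ∉ T' → c' i = 0) →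
      |(A *ᵥ c) ⬝ᵥ (A *ᵥ c')| ≤ θ * (l2norm c * l2norm c')}.Nonempty := by
  obtain ⟨M, hM, h⟩ := exists_l2norm_mulVec_le A
  refine ⟨M * M, by positivity, fun T T' _ _ _ c c' _ _ => ?_⟩
  calc _ ≤ l2norm (A *ᵥ c) * l2norm (A *ᵥ c') := abs_dotProduct_le _ _
    _ ≤ (M * l2norm c) * (M * l2norm c') :=
      mul_le_mul (h c) (h c') (l2norm_nonneg _) (mul_nonneg hM (l2norm_nonneg _))
    _ = _ := by ring

theorem roc_nonneg {n m : ℕ} (A : Matrix (Fin n) (Fin m) ℝ) (S S' : ℕ) : 0 ≤ roc A S S' :=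
  le_csInf (roc_set_nonempty A S S') fun _ h => h.1

theorem abs_dotProduct_mulVec_le_roc {n m : ℕ} (A : Matrix (Fin n) (Fin m) ℝ) {S S' : ℕ}
    {T T' : Finset (Fin m)} (hd : Disjoint T T') (hT : T.card ≤ S) (hT' : T'.card ≤ S')
    {c c' : Fin m → ℝ} (hc : ∀ i, i ∉ T → c i = 0) (hc' : ∀ i, i ∉ T' → c' i = 0) :
    |(A *ᵥ c) ⬝ᵥ (A *ᵥ c')| ≤ roc A S S' * (l2norm c * l2norm c') := by
  have := le_add_csInf_mul (roc_set_nonempty A S S')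
    (mul_nonneg (l2norm_nonneg c) (l2norm_nonneg c'))
    (a := |(A *ᵥ c) ⬝ᵥ (A *ᵥ c')|) (c := 0)
    fun δ hδ => by linarith [hδ.2 T T' hd hT hT' c c' hc hc']
  unfold roc
  linarith

/-- A matrix with more columns than rows and with nonzero columns has a pair of columns that are
not orthogonal. -/
theorem roc_pos {n m : ℕ} (hnm : n < m) (A : Matrix (Fin n) (Fin m) ℝ) {S S' k : ℕ}
    (hS : 1 ≤ S) (hS' : 1 ≤ S') (hk : 1 ≤ k) (hδ : ric A k < 1) : 0 < roc A S S' := by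
  by_contra hneg
  have hθ : roc A S S' = 0 := le_antisymm (not_lt.1 hneg) (roc_nonneg _ _ _)
  -- If the constant vanished, distinct columns would be orthogonal. Pairing a kernel vector `c`,
  -- which exists because `n < m`, with a column where `c i ≠ 0` leaves `c i` times the squared norm
  -- of that column, so the column is zero, against `ric A k < 1`.
  have horth : ∀ i j, i ≠ j → (A *ᵥ Pi.single i 1) ⬝ᵥ (A *ᵥ Pi.single j 1) = 0 := by
    intro i j hij
    have := abs_dotProduct_mulVec_le_roc A (T := {i}) (T' := {j}) (S := S) (S' := S')
      (by simpa using hij) (by simpa using hS) (by simpa using hS')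
      (c := Pi.single i 1) (c' := Pi.single j 1)
      (fun a ha => Pi.single_eq_of_ne (by simpa using ha) _)
      (fun a ha => Pi.single_eq_of_ne (by simpa using ha) _)
    rw [hθ, zero_mul] at this
    exact abs_eq_zero.1 (le_antisymm this (abs_nonneg _))
  obtain ⟨c, hc, hc0⟩ : ∃ c, A *ᵥ c = 0 ∧ c ≠ 0 := by
    by_contra! h
    have hinj : Function.Injective A.mulVecLin :=
      (injective_iff_map_eq_zero _).2 fun c hc => h c hc
    have := LinearMap.finrank_le_finrank_of_injective hinj
    simp at this
    omega
  obtain ⟨i, hi⟩ := Function.ne_iff.1 hc0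
  have hsum : c = ∑ j, c j • (Pi.single j 1 : Fin m → ℝ) := by
    funext a; simp [Finset.sum_apply, Pi.single_apply]
  have h0 : (A *ᵥ Pi.single i 1) ⬝ᵥ (A *ᵥ c) = 0 := by rw [hc, dotProduct_zero]
  rw [hsum, Matrix.mulVec_sum, dotProduct_sum, Finset.sum_eq_single i] at h0
  · rw [Matrix.mulVec_smul, dotProduct_smul, ← l2norm_sq, smul_eq_mul] at h0
    have h1 := (mul_eq_zero.1 h0).resolve_left hi
    have h2 := ric_lower A (S := k) (T := {i}) (by simpa using hk) (c := Pi.single i 1)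
      (fun a ha => Pi.single_eq_of_ne (by simpa using ha) _)
    rw [h1, l2norm_sq] at h2
    simp at h2
    linarith
  · intro j _ hj
    rw [Matrix.mulVec_smul, dotProduct_smul, horth i j hj.symm, smul_zero]
  · simp

/-- Restricted orthogonality from restricted isometry. -/
theorem abs_dotProduct_mulVec_le_ric {n m : ℕ} (A : Matrix (Fin n) (Fin m) ℝ) {S : ℕ}
    {T U : Finset (Fin m)} (hd : Disjoint T U) (hTU : (T ∪ U).card ≤ S)
    {u v : Fin m → ℝ} (hu : ∀ i, i ∉ T → u i = 0) (hv : ∀ i, i ∉ U → v i = 0) :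
    |(A *ᵥ u) ⬝ᵥ (A *ᵥ v)| ≤ ric A S * (l2norm u * l2norm v) := by
  -- Polarization: the upper isometry bound for `u + v` minus the lower one for `u - v`, which have
  -- the same norm by disjointness of supports.
  have key : ∀ u v : Fin m → ℝ, (∀ i, i ∉ T → u i = 0) → (∀ i, i ∉ U → v i = 0) →
      (A *ᵥ u) ⬝ᵥ (A *ᵥ v) ≤ ric A S * (l2norm u ^ 2 + l2norm v ^ 2) / 2 := by
    intro u v hu hv
    have hs : ∀ i, i ∉ T ∪ U → (u + v) i = 0 := fun i hi => by
      simp only [Finset.mem_union, not_or] at hi; simp [hu i hi.1, hv i hi.2]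
    have hs' : ∀ i, i ∉ T ∪ U → (u + -v) i = 0 := fun i hi => by
      simp only [Finset.mem_union, not_or] at hi; simp [hu i hi.1, hv i hi.2]
    have h1 := ric_upper A hTU hs
    have h2 := ric_lower A hTU hs'
    rw [l2norm_add_sq_of_disjoint hd hu hv] at h1
    rw [l2norm_add_sq_of_disjoint hd hu (fun i hi => by simp [hv i hi])] at h2
    have h3 : l2norm (-v) ^ 2 = l2norm v ^ 2 := by simp [l2norm_sq]
    rw [h3] at h2
    have h4 : l2norm (A *ᵥ (u + v)) ^ 2 - l2norm (A *ᵥ (u + -v)) ^ 2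
        = 4 * ((A *ᵥ u) ⬝ᵥ (A *ᵥ v)) := by
      simp only [l2norm_sq, Matrix.mulVec_add, Matrix.mulVec_neg, dotProduct_add, add_dotProduct,
        dotProduct_neg, neg_dotProduct]
      rw [dotProduct_comm (A *ᵥ v) (A *ᵥ u)]
      ring
    linarith
  have key2 : ∀ u v : Fin m → ℝ, (∀ i, i ∉ T → u i = 0) → (∀ i, i ∉ U → v i = 0) →
      (A *ᵥ u) ⬝ᵥ (A *ᵥ v) ≤ ric A S * (l2norm u * l2norm v) := by
    intro u v hu hv
    rcases (l2norm_nonneg u).eq_or_lt with h0 | h0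
    · rw [l2norm_eq_zero h0.symm]; simp [l2norm_zero]
    rcases (l2norm_nonneg v).eq_or_lt with h1 | h1
    · rw [l2norm_eq_zero h1.symm]; simp [l2norm_zero]
    -- Rescaling both vectors to the common norm `‖u‖ ‖v‖` turns the arithmetic mean of squares into
    -- the product.
    have h := key (l2norm v • u) (l2norm u • v) (fun i hi => by simp [hu i hi])
      (fun i hi => by simp [hv i hi])
    rw [l2norm_smul, l2norm_smul, abs_of_pos h0, abs_of_pos h1, Matrix.mulVec_smul,
      Matrix.mulVec_smul, smul_dotProduct, dotProduct_smul, smul_eq_mul, smul_eq_mul] at h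
    have hp := mul_pos h0 h1
    refine le_of_mul_le_mul_left ?_ hp
    linarith
  refine abs_le.2 ⟨?_, key2 u v hu hv⟩
  have h := key2 (-u) v (fun i hi => by simp [hu i hi]) hv
  have h3 : l2norm (-u) = l2norm u := by
    rw [← neg_one_smul ℝ u, l2norm_smul]; simp
  rw [h3, Matrix.mulVec_neg, neg_dotProduct] at h
  linarith

/-! ## Sparse block decompositions -/

/-- A finite set with more than `k` elements has a subset of `k` elements on which a given function
takes its largest values. -/
theorem exists_subset_card_eq_forall_le {α : Type*} [DecidableEq α] (f : α → ℝ) (k : ℕ)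
    (V : Finset α) (hV : k ≤ V.card) :
    ∃ W ⊆ V, W.card = k ∧ ∀ i ∈ W, ∀ j ∈ V \ W, f j ≤ f i := by
  induction k with
  | zero => exact ⟨∅, by simp, by simp, by simp⟩
  | succ k ih =>
    obtain ⟨W, hWV, hW, hle⟩ := ih (by omega)
    have hne : (V \ W).Nonempty := by
      rw [← Finset.card_pos, Finset.card_sdiff_of_subset hWV]; omega
    obtain ⟨a, ha, hmax⟩ := Finset.exists_max_image (V \ W) f hne
    have haV := (Finset.mem_sdiff.1 ha).1
    have haW := (Finset.mem_sdiff.1 ha).2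
    refine ⟨insert a W, Finset.insert_subset haV hWV, by simp [haW, hW], ?_⟩
    intro i hi j hj
    have hj' : j ∈ V \ W := by
      simp only [Finset.mem_sdiff, Finset.mem_insert, not_or] at hj ⊢
      exact ⟨hj.1, hj.2.2⟩
    rcases Finset.mem_insert.1 hi with rfl | hi
    · exact hmax j hj'
    · exact hle i hi j hj'

/-- A set with more than `k` elements contains a block of `k` elements which carries a bound for the
entries outside the block. -/
theorem exists_block {m : ℕ} (h : Fin m → ℝ) {k : ℕ} (hk : 1 ≤ k) (V : Finset (Fin m))
    (hV : k ≤ V.card) : ∃ W ⊆ V, W.card = k ∧ ∃ M, 0 ≤ M ∧ (∀ j ∈ V \ W, |h j| ≤ M) ∧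
      √k * M ≤ (∑ i ∈ W, |h i|) / √k := by
  obtain ⟨W, hWV, hW, hle⟩ := exists_subset_card_eq_forall_le (fun i => |h i|) k V hV
  have hne : W.Nonempty := by rw [← Finset.card_pos]; omega
  -- The bound `M` is the smallest magnitude in the block; it dominates everything outside and is at
  -- most the average over the block.
  obtain ⟨a, ha, hmin⟩ := Finset.exists_min_image W (fun i => |h i|) hne
  refine ⟨W, hWV, hW, |h a|, abs_nonneg _, fun j hj => hle a ha j hj, ?_⟩
  have hk' : (0 : ℝ) < √k := Real.sqrt_pos.2 (by exact_mod_cast hk)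
  rw [le_div_iff₀ hk']
  have h1 := Finset.card_nsmul_le_sum W (fun i => |h i|) |h a| hmin
  rw [hW, nsmul_eq_mul] at h1
  calc _ = (√k * √k) * |h a| := by ring
    _ = k * |h a| := by rw [Real.mul_self_sqrt (Nat.cast_nonneg k)]
    _ ≤ _ := h1

/-- Blocks of `k` largest entries are peeled off one at a time. The first is paid for by `√k * M`;
each later one is bounded by the average magnitude of the block before it, so the charges add up to
the scaled `ℓ₁` norm. -/
theorem subadditive_restrictTo_le {m : ℕ} (h : Fin m → ℝ) {k : ℕ} (hk : 1 ≤ k)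
    (p : (Fin m → ℝ) → ℝ) (hp : ∀ u v, p (u + v) ≤ p u + p v) {C : ℝ} (hC : 0 ≤ C) (M : ℝ)
    (hM : 0 ≤ M) (V : Finset (Fin m)) (hV : ∀ i ∈ V, |h i| ≤ M)
    (hpC : ∀ W ⊆ V, W.card ≤ k → p (restrictTo W h) ≤ C * l2norm (restrictTo W h)) :
    p (restrictTo V h) ≤ C * (√k * M + (∑ i ∈ V, |h i|) / √k) := by
  induction hn : V.card using Nat.strong_induction_on generalizing V M with
  | _ n ih =>
  by_cases hcard : V.card ≤ k
  · refine (hpC V subset_rfl hcard).trans (mul_le_mul_of_nonneg_left ?_ hC)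
    refine (l2norm_restrictTo_le hM hcard hV).trans ?_
    have : 0 ≤ (∑ i ∈ V, |h i|) / √k :=
      div_nonneg (Finset.sum_nonneg fun i _ => abs_nonneg _) (Real.sqrt_nonneg _)
    linarith
  · obtain ⟨W, hWV, hW, M', hM', hle, hsum⟩ := exists_block h hk V (by omega)
    have h1 : p (restrictTo W h) ≤ C * (√k * M) :=
      (hpC W hWV hW.le).trans (mul_le_mul_of_nonneg_left
        (l2norm_restrictTo_le hM hW.le fun i hi => hV i (hWV hi)) hC)
    have h2 := ih (V \ W).card (by rw [Finset.card_sdiff_of_subset hWV]; omega) M' hM' (V \ W)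
      hle (fun W' hW' => hpC W' (hW'.trans Finset.sdiff_subset)) rfl
    have h3 := hp (restrictTo W h) (restrictTo (V \ W) h)
    rw [restrictTo_add_sdiff hWV] at h3
    have h4 := mul_le_mul_of_nonneg_left hsum hC
    rw [← Finset.sum_sdiff hWV, add_div]
    linarith

/-- After the removal of a suitable block of at most `k` entries, every subadditive functional that
is bounded on `k`-sparse vectors is bounded by the scaled `ℓ₁` norm. -/
theorem exists_block_forall_subadditive {m : ℕ} (h : Fin m → ℝ) {k : ℕ} (hk : 1 ≤ k)
    (V : Finset (Fin m)) :
    ∃ W ⊆ V, W.card ≤ k ∧ ∀ p : (Fin m → ℝ) → ℝ, (∀ u v, p (u + v) ≤ p u + p v) → p 0 ≤ 0 →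
      ∀ C, 0 ≤ C → (∀ W' ⊆ V \ W, W'.card ≤ k →
        p (restrictTo W' h) ≤ C * l2norm (restrictTo W' h)) →
      p (restrictTo (V \ W) h) ≤ C * ((∑ i ∈ V, |h i|) / √k) := by
  by_cases hcard : V.card ≤ k
  · refine ⟨V, subset_rfl, hcard, fun p _ hp0 C hC _ => ?_⟩
    rw [Finset.sdiff_self, restrictTo_empty]
    exact hp0.trans (mul_nonneg hC
      (div_nonneg (Finset.sum_nonneg fun i _ => abs_nonneg _) (Real.sqrt_nonneg _)))
  · obtain ⟨W, hWV, hW, M, hM, hle, hsum⟩ := exists_block h hk V (by omega)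
    refine ⟨W, hWV, hW.le, fun p hp _ C hC hpC => ?_⟩
    refine (subadditive_restrictTo_le h hk p hp hC M hM (V \ W) hle hpC).trans
      (mul_le_mul_of_nonneg_left ?_ hC)
    rw [← Finset.sum_sdiff hWV, add_div]
    linarith

/-! ## Stability of `ℓ₁` minimization -/

/-- The cone condition satisfied by the error of an `ℓ₁` minimizer. -/
theorem sum_abs_compl_le_of_l1norm_le {m : ℕ} {b h : Fin m → ℝ} (hle : l1norm (b + h) ≤ l1norm b)
    (D : Finset (Fin m)) :
    ∑ i ∈ Dᶜ, |h i| ≤ ∑ i ∈ D, |h i| + 2 * ∑ i ∈ Dᶜ, |b i| := by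
  unfold l1norm at hle
  rw [← Finset.sum_add_sum_compl D, ← Finset.sum_add_sum_compl D] at hle
  have h1 : ∑ i ∈ D, |b i| - ∑ i ∈ D, |h i| ≤ ∑ i ∈ D, |(b + h) i| := by
    rw [← Finset.sum_sub_distrib]
    refine Finset.sum_le_sum fun i _ => ?_
    have := abs_sub_abs_le_abs_sub (b i) (-h i)
    simpa using this
  have h2 : ∑ i ∈ Dᶜ, |h i| - ∑ i ∈ Dᶜ, |b i| ≤ ∑ i ∈ Dᶜ, |(b + h) i| := by
    rw [← Finset.sum_sub_distrib]
    refine Finset.sum_le_sum fun i _ => ?_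
    have := abs_sub_abs_le_abs_sub (h i) (-b i)
    simpa [add_comm] using this
  linarith

theorem add_le_sqrt_two_mul {a b c : ℝ} (hc : 0 ≤ c) (h : c ^ 2 = a ^ 2 + b ^ 2) :
    a + b ≤ √2 * c := by
  apply le_of_sq_le_sq _ (by positivity)
  rw [mul_pow, Real.sq_sqrt (by norm_num), h]
  nlinarith [sq_nonneg (a - b)]

/-- The part of the error on `D ∪ W` is controlled by the `ℓ₁` norm of the error off `D`. -/
theorem one_sub_ric_mul_l2norm_le {n m : ℕ} (A : Matrix (Fin n) (Fin m) ℝ) {k : ℕ} {R η : ℝ}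
    {h : Fin m → ℝ} (hA : l2norm (A *ᵥ h) ≤ η) {D W : Finset (Fin m)}
    (hD : D.card ≤ k) (hWD : W ⊆ Dᶜ) (hW : W.card ≤ k) (hR : 0 ≤ R)
    (hblocks : ∀ p : (Fin m → ℝ) → ℝ, (∀ u v, p (u + v) ≤ p u + p v) → p 0 ≤ 0 →
      ∀ C, 0 ≤ C → (∀ W' ⊆ Dᶜ \ W, W'.card ≤ k →
        p (restrictTo W' h) ≤ C * l2norm (restrictTo W' h)) →
      p (restrictTo (Dᶜ \ W) h) ≤ C * R) :
    (1 - ric A (2 * k)) * l2norm (restrictTo (D ∪ W) h) ≤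
      √(1 + ric A (2 * k)) * η + √2 * ric A (2 * k) * R := by
  have hδ0 := ric_nonneg A (2 * k)
  have hdisj : Disjoint D W := by
    rw [Finset.disjoint_left]; intro i hi hiW
    exact Finset.mem_compl.1 (hWD hiW) hi
  have hcard : (D ∪ W).card ≤ 2 * k := (Finset.card_union_le _ _).trans (by omega)
  set δ := ric A (2 * k)
  set g := restrictTo (D ∪ W) h with hg
  have hgs : ∀ i, i ∉ D ∪ W → g i = 0 := fun i hi => restrictTo_of_notMem h hi
  set H := l2norm g with hH
  have hH0 : 0 ≤ H := l2norm_nonneg g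
  -- The final estimate is quadratic in `H` and is divided by `H`, so `H = 0` is treated apart.
  rcases hH0.eq_or_lt with h0 | hpos
  · rw [← h0, mul_zero]
    have := (l2norm_nonneg _).trans hA
    positivity
  have hsplit : h = g + restrictTo (Dᶜ \ W) h := by
    have : Dᶜ \ W = (D ∪ W)ᶜ := by ext i; simp
    rw [this, hg, restrictTo_add_compl]
  have hlow := ric_lower A hcard hgs
  have hAg : l2norm (A *ᵥ g) ≤ √(1 + δ) * H := by
    apply le_of_sq_le_sq _ (by positivity)
    rw [mul_pow, Real.sq_sqrt (by positivity)]
    exact ric_upper A hcard hgs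
  have hp := hblocks (fun v => -((A *ᵥ g) ⬝ᵥ (A *ᵥ v)))
    (fun u v => by rw [Matrix.mulVec_add, dotProduct_add]; linarith) (by simp)
    (√2 * δ * H) (by positivity) (by
      intro W' hW' hW'k
      have hgDW : g = restrictTo D h + restrictTo W h := restrictTo_union hdisj h
      have hd1 : Disjoint D W' := by
        rw [Finset.disjoint_left]; intro i hi hiW
        have := hW' hiW; simp at this; exact this.1 hi
      have hd2 : Disjoint W W' := by
        rw [Finset.disjoint_left]; intro i hi hiW
        have := hW' hiW; simp at this; exact this.2 hi
      have hs : ∀ (T : Finset (Fin m)) i, i ∉ T → restrictTo T h i = 0 :=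
        fun T i hi => restrictTo_of_notMem h hi
      have e1 := abs_dotProduct_mulVec_le_ric A hd1 (S := 2 * k)
        ((Finset.card_union_le _ _).trans (by omega)) (hs D) (hs W')
      have e2 := abs_dotProduct_mulVec_le_ric A hd2 (S := 2 * k)
        ((Finset.card_union_le _ _).trans (by omega)) (hs W) (hs W')
      -- `D` and `W` are paired with `W'` separately, so that only `2 * k` columns are involved at a
      -- time; recombining the two norms costs the factor `√2`.
      have e3 : l2norm (restrictTo D h) + l2norm (restrictTo W h) ≤ √2 * H := by
        apply add_le_sqrt_two_mul hH0
        rw [hH, hgDW]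
        exact l2norm_add_sq_of_disjoint hdisj (hs D) (hs W)
      have e4 := mul_le_mul_of_nonneg_left e3 (mul_nonneg hδ0 (l2norm_nonneg (restrictTo W' h)))
      have e5 := neg_abs_le ((A *ᵥ restrictTo D h) ⬝ᵥ (A *ᵥ restrictTo W' h))
      have e6 := neg_abs_le ((A *ᵥ restrictTo W h) ⬝ᵥ (A *ᵥ restrictTo W' h))
      have e7 : (A *ᵥ g) ⬝ᵥ (A *ᵥ restrictTo W' h) =
          (A *ᵥ restrictTo D h) ⬝ᵥ (A *ᵥ restrictTo W' h) +
          (A *ᵥ restrictTo W h) ⬝ᵥ (A *ᵥ restrictTo W' h) := by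
        rw [hgDW, Matrix.mulVec_add, add_dotProduct]
      simp only [e7]
      linarith)
  have hsq : l2norm (A *ᵥ g) ^ 2 =
      (A *ᵥ g) ⬝ᵥ (A *ᵥ h) + -((A *ᵥ g) ⬝ᵥ (A *ᵥ restrictTo (Dᶜ \ W) h)) := by
    have hAh : A *ᵥ h = A *ᵥ g + A *ᵥ restrictTo (Dᶜ \ W) h := by
      rw [← Matrix.mulVec_add, ← hsplit]
    rw [hAh, dotProduct_add, l2norm_sq]
    ring
  have hin : (A *ᵥ g) ⬝ᵥ (A *ᵥ h) ≤ √(1 + δ) * H * η :=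
    (le_abs_self _).trans ((abs_dotProduct_le _ _).trans
      (mul_le_mul hAg hA (l2norm_nonneg _) (by positivity)))
  refine le_of_mul_le_mul_left ?_ hpos
  nlinarith

/-- Both `b` and `β` are feasible, so `‖A h‖ ≤ 2ε` for `h = β - b`. With `H` the norm of `h` on `D ∪
W` and `e` the scaled tail of `b` off `D`, the cone condition gives `R ≤ H + 2e`. Inserting this in
the isometry estimate and collecting `H` produces the denominator `1 - (√2 + 1) δ`, and `‖h‖ ≤ H + R
≤ 2H + 2e`. The set `D` need not be the support of `b`. -/
theorem l1_error_le {n m : ℕ} (A : Matrix (Fin n) (Fin m) ℝ) {k : ℕ} (hk : 1 ≤ k)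
    (hδ : (√2 + 1) * ric A (2 * k) < 1) {ε : ℝ} {b β : Fin m → ℝ} {w : Fin n → ℝ}
    (hw : l2norm w ≤ ε) (hβ : IsCSSolution A ε (A *ᵥ b + w) β) {D : Finset (Fin m)}
    (hD : D.card ≤ k) :
    l2norm (β - b) ≤ constC1 A (2 * k) * ε + constC2 A (2 * k) * ((∑ i ∈ Dᶜ, |b i|) / √k) := by
  have hδ0 := ric_nonneg A (2 * k)
  have hk' : (0 : ℝ) < √k := Real.sqrt_pos.2 (by exact_mod_cast hk)
  set h := β - b with hh
  have hle : l1norm (b + h) ≤ l1norm b := by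
    have := hβ.2 b (by rw [add_sub_cancel_left]; exact hw)
    simpa [hh] using this
  have hA : l2norm (A *ᵥ h) ≤ 2 * ε := by
    have : A *ᵥ h = w - (A *ᵥ b + w - A *ᵥ β) := by
      rw [hh, Matrix.mulVec_sub]; abel
    rw [this]
    refine (l2norm_sub_le _ _).trans ?_
    linarith [hβ.1]
  obtain ⟨W, hWD, hW, hblocks⟩ := exists_block_forall_subadditive h hk Dᶜ
  set R := (∑ i ∈ Dᶜ, |h i|) / √k with hR
  have hR0 : 0 ≤ R := div_nonneg (Finset.sum_nonneg fun i _ => abs_nonneg _) hk'.le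
  have hmain := one_sub_ric_mul_l2norm_le A hA hD hWD hW hR0 hblocks
  have htail : l2norm (restrictTo (Dᶜ \ W) h) ≤ R := by
    have := hblocks l2norm l2norm_add_le l2norm_zero.le 1 zero_le_one
      (fun W' _ _ => by rw [one_mul])
    rwa [one_mul] at this
  set H := l2norm (restrictTo (D ∪ W) h) with hH
  set e := (∑ i ∈ Dᶜ, |b i|) / √k with he
  have hRle : R ≤ H + 2 * e := by
    have h1 := sum_abs_compl_le_of_l1norm_le hle D
    have h2 := sum_abs_le_sqrt_mul_l2norm hD h
    have h3 := l2norm_restrictTo_mono (Finset.subset_union_left (s₁ := D) (s₂ := W)) h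
    have h4 : ∑ i ∈ D, |h i| ≤ √k * H := h2.trans (mul_le_mul_of_nonneg_left h3 hk'.le)
    rw [hR, div_le_iff₀ hk']
    have : e * √k = ∑ i ∈ Dᶜ, |b i| := div_mul_cancel₀ _ hk'.ne'
    linarith
  have htotal : l2norm h ≤ H + R := by
    have : h = restrictTo (D ∪ W) h + restrictTo (Dᶜ \ W) h := by
      have : Dᶜ \ W = (D ∪ W)ᶜ := by ext i; simp
      rw [this, restrictTo_add_compl]
    calc l2norm h = _ := congrArg l2norm this
      _ ≤ _ := l2norm_add_le _ _
      _ ≤ H + R := by linarith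
  have hden : 0 < 1 - (√2 + 1) * ric A (2 * k) := by linarith
  unfold constC1 constC2
  suffices hs : l2norm h ≤ (4 * √(1 + ric A (2 * k)) * ε + 2 * (1 + (√2 - 1) * ric A (2 * k)) * e) /
      (1 - (√2 + 1) * ric A (2 * k)) from hs.trans_eq (by ring)
  rw [le_div_iff₀ hden]
  set δ := ric A (2 * k)
  have hs2 : 0 ≤ √2 := Real.sqrt_nonneg 2
  have h1 : (1 - (√2 + 1) * δ) * H ≤ √(1 + δ) * (2 * ε) + √2 * δ * (2 * e) := by
    have := mul_le_mul_of_nonneg_left hRle (mul_nonneg hs2 hδ0)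
    linarith
  have h2 : l2norm h ≤ 2 * H + 2 * e := by linarith
  have := mul_le_mul_of_nonneg_right h2 hden.le
  linarith

/-! ## Least squares estimates -/

theorem colSub_mulVec {n m : ℕ} (A : Matrix (Fin n) (Fin m) ℝ) {T : Finset (Fin m)}
    {c : Fin m → ℝ} (hc : ∀ i, i ∉ T → c i = 0) :
    colSub A T *ᵥ (fun i : {i // i ∈ T} => c i) = A *ᵥ c := by
  funext a
  simp only [Matrix.mulVec, dotProduct, colSub, Matrix.submatrix_apply, id]
  rw [Finset.sum_coe_sort T (fun i => A a i * c i)]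
  exact Finset.sum_subset (Finset.subset_univ T) fun i _ hi => by simp [hc i hi]

/-- The residual of a least squares estimate on `T` is orthogonal to the columns in `T`. -/
theorem IsLSEstimate.dotProduct_residual {n m : ℕ} {A : Matrix (Fin n) (Fin m) ℝ}
    {T : Finset (Fin m)} {y : Fin n → ℝ} {z : Fin m → ℝ} (hz : IsLSEstimate A T y z)
    {c : Fin m → ℝ} (hc : ∀ i, i ∉ T → c i = 0) : (A *ᵥ c) ⬝ᵥ (y - A *ᵥ z) = 0 := by
  obtain ⟨⟨P, hP, hzP⟩, hz0⟩ := hz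
  have h1 : A *ᵥ z = (colSub A T * P) *ᵥ y := by
    rw [← colSub_mulVec A hz0, ← Matrix.mulVec_mulVec]
    congr 1
    funext i; exact hzP i
  set c' : {i // i ∈ T} → ℝ := fun i => c i
  rw [← colSub_mulVec A hc, h1, dotProduct_sub, sub_eq_zero, Matrix.dotProduct_mulVec,
    ← Matrix.mulVec_transpose, hP.symm_left, Matrix.mulVec_mulVec, hP.mul_mul]

/-- The error of a least squares estimate on the set `T`. -/
theorem IsLSEstimate.error_on_support {n m : ℕ} {A : Matrix (Fin n) (Fin m) ℝ}
    {T : Finset (Fin m)} {w : Fin n → ℝ} {x z : Fin m → ℝ} {ε X : ℝ} (hw : l2norm w ≤ ε)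
    (hz : IsLSEstimate A T (A *ᵥ x + w) z) {a b : ℕ} (ha : T.card ≤ a)
    (hb : (supp x \ T).card ≤ b) (hδ : ric A a < 1 / 2)
    (hX : l2norm (restrictTo (supp x \ T) x) ≤ X) :
    restrictTo T (x - z) = 0 ∨
      l2norm (restrictTo T (x - z)) < √2 * ε + 2 * (roc A a b * X) := by
  have hDT : Disjoint T (supp x \ T) := Finset.disjoint_sdiff
  have hD : ∀ i, i ∉ T → x i ≠ 0 → i ∈ supp x \ T := fun i hi hxi => by
    simp [supp, hi, hxi]
  set D := supp x \ T
  have hsplit : x = restrictTo T x + restrictTo D x := by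
    funext i
    by_cases hi : i ∈ T
    · simp [restrictTo, hi, Finset.disjoint_left.1 hDT hi]
    · by_cases hiD : i ∈ D
      · simp [restrictTo, hi, hiD]
      · have : x i = 0 := by_contra fun h => hiD (hD i hi h)
        simp [restrictTo, hi, hiD, this]
  set e := restrictTo T (x - z) with he
  have hes : ∀ i, i ∉ T → e i = 0 := fun i hi => restrictTo_of_notMem _ hi
  have hxz : x - z = e + restrictTo D x := by
    funext i
    by_cases hi : i ∈ T
    · simp [he, restrictTo, hi, Finset.disjoint_left.1 hDT hi]
    · have h1 := congrFun hsplit i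
      simp only [Pi.add_apply, restrictTo_of_notMem x hi, zero_add] at h1
      simp [hes i hi, hz.2 i hi, ← h1]
  have hlow := ric_lower A ha hes
  have horth := hz.dotProduct_residual hes
  have hres : A *ᵥ x + w - A *ᵥ z = A *ᵥ e + A *ᵥ restrictTo D x + w := by
    rw [← Matrix.mulVec_add, ← hxz, Matrix.mulVec_sub]; abel
  -- The normal equations, tested against the error itself, express `‖A e‖²` through the missed
  -- entries and the noise.
  rw [hres, dotProduct_add, dotProduct_add, ← l2norm_sq] at horth
  have h1 := (abs_dotProduct_mulVec_le_roc A hDT ha hb hes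
    (fun i hi => restrictTo_of_notMem x hi)).trans' (neg_le_abs _)
  have h2 := (abs_dotProduct_le (A *ᵥ e) w).trans' (neg_le_abs _)
  rcases (l2norm_nonneg e).eq_or_lt with h0 | hpos
  · exact Or.inl (l2norm_eq_zero h0.symm)
  right
  have hθ := roc_nonneg A a b
  set v := l2norm e
  set u := l2norm (A *ᵥ e)
  have hu0 : 0 ≤ u := l2norm_nonneg _
  have hX0 : 0 ≤ X := (l2norm_nonneg _).trans hX
  have h3 : roc A a b * (v * l2norm (restrictTo D x)) ≤ roc A a b * X * v := by
    have := mul_le_mul_of_nonneg_left hX (mul_nonneg hθ hpos.le)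
    linarith
  have h4 : u * l2norm w ≤ u * ε := mul_le_mul_of_nonneg_left hw hu0
  have hu : u ^ 2 ≤ roc A a b * X * v + u * ε := by linarith
  -- Here `1 - ric A a > 1 / 2`, and strictness needs `e ≠ 0`. It is kept to the end because the
  -- deletion step requires a strict bound.
  have hv : v ^ 2 < 2 * u ^ 2 := by nlinarith [pow_pos hpos 2]
  have hs2 : √2 * √2 = 2 := Real.mul_self_sqrt (by norm_num)
  have hvu : v < √2 * u := by
    apply lt_of_pow_lt_pow_left₀ 2 (by positivity)
    rw [mul_pow, Real.sq_sqrt (by norm_num)]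
    exact hv
  have hupos : 0 < u := by
    rcases hu0.eq_or_lt with h | h
    · rw [← h, mul_zero] at hvu; linarith
    · exact h
  have hB : 0 ≤ roc A a b * X := mul_nonneg hθ hX0
  have h5 : u ≤ √2 * (roc A a b * X) + ε := by
    refine le_of_mul_le_mul_left ?_ hupos
    have := mul_le_mul_of_nonneg_left hvu.le hB
    linarith
  have := mul_le_mul_of_nonneg_left h5 (Real.sqrt_nonneg 2)
  calc v < √2 * u := hvu
    _ ≤ √2 * (√2 * (roc A a b * X) + ε) := this
    _ = √2 * √2 * (roc A a b * X) + √2 * ε := by ring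
    _ = _ := by rw [hs2]; ring

theorem mem_supp {m : ℕ} {x : Fin m → ℝ} {i : Fin m} : i ∈ supp x ↔ x i ≠ 0 := by
  simp [supp]

theorem mem_level {m : ℕ} {x : Fin m → ℝ} {a : ℝ} {i : Fin m} : i ∈ level x a ↔ |x i| = a := by
  simp [level]

theorem mem_moves {m : ℕ} {x x' : Fin m → ℝ} {a b : ℝ} {i : Fin m} :
    i ∈ moves x x' a b ↔ |x i| = a ∧ |x' i| = b := by
  simp [moves]

/-! ## The CS-residual step -/

theorem constC2_pos {n m : ℕ} (A : Matrix (Fin n) (Fin m) ℝ) {S : ℕ}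
    (hδ : (√2 + 1) * ric A S < 1) : 0 < constC2 A S := by
  have h1 : (1 : ℝ) ≤ √2 := Real.one_le_sqrt.2 (by norm_num)
  have h2 := mul_nonneg (sub_nonneg.2 h1) (ric_nonneg A S)
  unfold constC2
  exact mul_pos zero_lt_two (div_pos (by linarith) (by linarith))

/-- The error of the CS-residual step. -/
theorem IsCSResidual.error_le {n m : ℕ} {A : Matrix (Fin n) (Fin m) ℝ}
    {T : Finset (Fin m)} {w : Fin n → ℝ} {x z : Fin m → ℝ} {ε X : ℝ} (hw : l2norm w ≤ ε)
    (hz : IsCSResidual A ε T (A *ᵥ x + w) z) {a k : ℕ} (ha : T.card ≤ a) (hk : 1 ≤ k)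
    (hb : (supp x \ T).card ≤ k) (hδ : ric A a < 1 / 2) (hδk : (√2 + 1) * ric A (2 * k) < 1)
    (hX : l2norm (restrictTo (supp x \ T) x) ≤ X) :
    l2norm (x - z) ≤ constC' A a k * ε + roc A a k * constC'' A a k * (X / √k) := by
  obtain ⟨xinit, β, hinit, hβ, rfl⟩ := hz
  have hy : A *ᵥ x + w - A *ᵥ xinit = A *ᵥ (x - xinit) + w := by
    rw [Matrix.mulVec_sub]; abel
  rw [hy] at hβ
  -- The block `D` is the missed set. Off it, `x - xinit` lives on `T`, so the `ℓ₁` tail is the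
  -- least squares error, at the price of a factor `√a`.
  have h1 := l1_error_le A hk hδk hw hβ hb
  have hε : 0 ≤ ε := (l2norm_nonneg _).trans hw
  have hX0 : 0 ≤ X := (l2norm_nonneg _).trans hX
  have hθ := roc_nonneg A a k
  have h2 : l2norm (restrictTo T (x - xinit)) ≤ √2 * ε + 2 * (roc A a k * X) := by
    rcases hinit.error_on_support hw ha hb hδ hX with h | h
    · rw [h, l2norm_zero]; positivity
    · exact h.le
  have h3 : ∑ i ∈ (supp x \ T)ᶜ, |(x - xinit) i| ≤ √a * (√2 * ε + 2 * (roc A a k * X)) := by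
    have : ∑ i ∈ (supp x \ T)ᶜ, |(x - xinit) i| = ∑ i ∈ T, |(x - xinit) i| := by
      symm
      refine Finset.sum_subset (fun i hi => by simp [hi]) fun i hi hiT => ?_
      have hxi : x i = 0 := by
        by_contra h
        exact Finset.mem_compl.1 hi (Finset.mem_sdiff.2 ⟨mem_supp.2 h, hiT⟩)
      simp [hxi, hinit.2 i hiT]
    rw [this]
    exact (sum_abs_le_sqrt_mul_l2norm ha _).trans
      (mul_le_mul_of_nonneg_left h2 (Real.sqrt_nonneg _))
  have h4 : x - (β + xinit) = (x - xinit) - β := by abel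
  rw [h4, l2norm_sub_comm]
  refine h1.trans ?_
  have h5 := mul_le_mul_of_nonneg_left
    (div_le_div_of_nonneg_right h3 (Real.sqrt_nonneg (k : ℝ))) (constC2_pos A hδk).le
  unfold constC' constC''
  rw [Real.sqrt_div (Nat.cast_nonneg a)]
  calc _ ≤ _ := add_le_add_right h5 _
    _ = _ := by ring

/-! ## The signal model -/

section
variable {m : ℕ} {x : ℕ → Fin m → ℝ} {S0 Sa d : ℕ} {r : ℝ}

/-- The prescribed levels `r, …, d r` already contain `S0` indices in total, hence exhaust the
support. -/
theorem SignalModel.abs_zero_eq (hx : SignalModel x S0 Sa d r) (hr : 0 < r) (hd : 1 ≤ d)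
    (i : Fin m) : ∃ j : ℕ, |x 0 i| = j * r := by
  set U := (Finset.Icc 1 d).biUnion fun j => level (x 0) ((j : ℝ) * r) with hU
  have hdisj : ((Finset.Icc 1 d : Finset ℕ) : Set ℕ).PairwiseDisjoint
      fun j => level (x 0) ((j : ℝ) * r) := by
    intro a _ b _ hab
    refine Finset.disjoint_left.2 fun i hi hi' => hab ?_
    rw [mem_level] at hi hi'
    exact_mod_cast mul_right_cancel₀ hr.ne' (hi.symm.trans hi')
  have hcard : U.card = S0 := by
    obtain ⟨e, rfl⟩ : ∃ e, d = e + 1 := ⟨d - 1, by omega⟩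
    rw [hU, Finset.card_biUnion hdisj, Finset.sum_Icc_succ_top (by omega),
      Finset.sum_congr rfl fun j hj => hx.init_small j (Finset.mem_Icc.1 hj).1
        (by have := (Finset.mem_Icc.1 hj).2; omega)]
    have := hx.init_large
    simp only [Finset.sum_const, Nat.card_Icc, smul_eq_mul]
    rw [← this, show 2 * (e + 1) - 2 = 2 * e by omega, add_tsub_cancel_right]
    ring
  have hsub : U ⊆ supp (x 0) := by
    intro i hi
    obtain ⟨j, hj, hij⟩ := Finset.mem_biUnion.1 hi
    rw [mem_level] at hij
    have : (0 : ℝ) < j := by exact_mod_cast (Finset.mem_Icc.1 hj).1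
    rw [mem_supp, ← abs_pos, hij]
    positivity
  have heq := Finset.eq_of_subset_of_card_le hsub (by rw [hcard, hx.init_card])
  by_cases hi : x 0 i = 0
  · exact ⟨0, by simp [hi]⟩
  · have : i ∈ U := by rw [heq]; exact mem_supp.2 hi
    obtain ⟨j, -, hij⟩ := Finset.mem_biUnion.1 this
    exact ⟨j, mem_level.1 hij⟩

/-- All magnitudes are multiples of `r`. -/
theorem SignalModel.abs_eq (hx : SignalModel x S0 Sa d r) (hr : 0 < r) (hd : 1 ≤ d) (t : ℕ)
    (i : Fin m) : ∃ j : ℕ, |x t i| = j * r := by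
  induction t with
  | zero => exact hx.abs_zero_eq hr hd i
  | succ t ih =>
    rcases hx.unchanged t i with h | ⟨j, -, h | h⟩
    · rwa [h]
    · exact ⟨j + 1, by rw [(mem_moves.1 h).2]; push_cast; rfl⟩
    · exact ⟨j, (mem_moves.1 h).2⟩

/-- This gap turns a strict bound by `2 * r` into equality with `r`. -/
theorem SignalModel.eq_or_two_mul_le (hx : SignalModel x S0 Sa d r) (hr : 0 < r) (hd : 1 ≤ d)
    {t : ℕ} {i : Fin m} (hi : i ∈ supp (x t)) : |x t i| = r ∨ 2 * r ≤ |x t i| := by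
  obtain ⟨j, hj⟩ := hx.abs_eq hr hd t i
  rw [mem_supp, ← abs_pos, hj] at hi
  rcases j with _ | _ | j
  · simp at hi
  · left; simpa using hj
  · right
    rw [hj]
    refine mul_le_mul_of_nonneg_right ?_ hr.le
    exact_mod_cast (by omega : 2 ≤ j + 1 + 1)

theorem SignalModel.supp_sdiff_supp_succ (hx : SignalModel x S0 Sa d r) (hr : 0 < r) (t : ℕ) :
    supp (x t) \ supp (x (t + 1)) ⊆ moves (x t) (x (t + 1)) (((0 : ℕ) + 1) * r) ((0 : ℕ) * r) := by
  intro i hi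
  rw [Finset.mem_sdiff, mem_supp, mem_supp, not_not] at hi
  rcases hx.unchanged t i with h | ⟨j, -, h | h⟩
  · rw [hi.2, abs_zero] at h
    exact absurd (abs_eq_zero.1 h.symm) hi.1
  · have := (mem_moves.1 h).2
    rw [hi.2, abs_zero] at this
    have : 0 < ((j : ℝ) + 1) * r := by positivity
    linarith
  · have h2 := (mem_moves.1 h).2
    rw [hi.2, abs_zero] at h2
    have hj : (j : ℝ) = 0 := (mul_eq_zero.1 h2.symm).resolve_right hr.ne'
    have : j = 0 := by exact_mod_cast hj
    rwa [this] at h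

theorem SignalModel.supp_succ_sdiff_supp (hx : SignalModel x S0 Sa d r) (hr : 0 < r) (t : ℕ) :
    supp (x (t + 1)) \ supp (x t) ⊆ moves (x t) (x (t + 1)) ((0 : ℕ) * r) (((0 : ℕ) + 1) * r) := by
  intro i hi
  rw [Finset.mem_sdiff, mem_supp, mem_supp, not_not] at hi
  rcases hx.unchanged t i with h | ⟨j, -, h | h⟩
  · rw [hi.2, abs_zero] at h
    exact absurd (abs_eq_zero.1 h) hi.1
  · have h2 := (mem_moves.1 h).1
    rw [hi.2, abs_zero] at h2
    have hj : (j : ℝ) = 0 := (mul_eq_zero.1 h2.symm).resolve_right hr.ne'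
    have : j = 0 := by exact_mod_cast hj
    rwa [this] at h
  · have := (mem_moves.1 h).1
    rw [hi.2, abs_zero] at this
    have : 0 < ((j : ℝ) + 1) * r := by positivity
    linarith

/-- Only the moves between `0` and `r` alter the support, and `Sa` additions balance `Sa` removals.
-/
theorem SignalModel.card_supp (hx : SignalModel x S0 Sa d r) (hr : 0 < r) (hd : 1 ≤ d) (t : ℕ) :
    (supp (x t)).card = S0 := by
  induction t with
  | zero => exact hx.init_card
  | succ t ih =>
    have h1 : supp (x t) \ supp (x (t + 1)) =
        moves (x t) (x (t + 1)) (((0 : ℕ) + 1) * r) ((0 : ℕ) * r) := by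
      refine subset_antisymm (hx.supp_sdiff_supp_succ hr t) fun i hi => ?_
      rw [mem_moves] at hi
      have h1 := hi.1
      have h2 := hi.2
      simp only [Nat.cast_zero, zero_add, one_mul, zero_mul, abs_eq_zero] at h1 h2
      rw [Finset.mem_sdiff, mem_supp, mem_supp, not_not]
      exact ⟨abs_pos.1 (h1 ▸ hr), h2⟩
    have h2 : supp (x (t + 1)) \ supp (x t) =
        moves (x t) (x (t + 1)) ((0 : ℕ) * r) (((0 : ℕ) + 1) * r) := by
      refine subset_antisymm (hx.supp_succ_sdiff_supp hr t) fun i hi => ?_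
      rw [mem_moves] at hi
      have h1 := hi.1
      have h2 := hi.2
      simp only [Nat.cast_zero, zero_add, one_mul, zero_mul, abs_eq_zero] at h1 h2
      rw [Finset.mem_sdiff, mem_supp, mem_supp, not_not]
      exact ⟨abs_pos.1 (h2 ▸ hr), h1⟩
    have c1 := Finset.card_sdiff_add_card_inter (supp (x t)) (supp (x (t + 1)))
    have c2 := Finset.card_sdiff_add_card_inter (supp (x (t + 1))) (supp (x t))
    rw [h1, hx.decrease t 0 (by omega)] at c1
    rw [h2, hx.increase t 0 (by omega), Finset.inter_comm] at c2
    omega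

/-- If the level `r` has `2 Sₐ` elements, they all leave it. -/
theorem SignalModel.level_subset_moves (hx : SignalModel x S0 Sa d r) (hr : 0 < r) (hd : 2 ≤ d)
    {t : ℕ} (hl : (level (x t) r).card = 2 * Sa) :
    level (x t) r ⊆ moves (x t) (x (t + 1)) (((0 : ℕ) + 1) * r) ((0 : ℕ) * r) ∪
      moves (x t) (x (t + 1)) ((1 : ℕ) * r) (((1 : ℕ) + 1) * r) := by
  -- The moves from `r` to `0` and from `r` to `2 * r` are disjoint, lie in the level and number `Sa
  -- + Sa`, so they fill it.
  refine (Finset.eq_of_subset_of_card_le ?_ ?_).symm.subset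
  · intro i hi
    rw [Finset.mem_union, mem_moves, mem_moves] at hi
    rw [mem_level]
    rcases hi with hi | hi <;> simpa using hi.1
  · rw [Finset.card_union_of_disjoint, hx.decrease t 0 (by omega), hx.increase t 1 (by omega), hl]
    · omega
    · refine Finset.disjoint_left.2 fun i hi hi' => ?_
      rw [mem_moves] at hi hi'
      have h := hi.2.symm.trans hi'.2
      simp only [Nat.cast_zero, Nat.cast_one, zero_mul] at h
      linarith

/-- Since the level `r` empties at each step, its next content is exactly the `Sa` additions and the
`Sa` decreases from `2 * r`; the latter exist because `d ≥ 2`. -/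
theorem SignalModel.card_level (hx : SignalModel x S0 Sa d r) (hr : 0 < r) (hd : 2 ≤ d) (t : ℕ) :
    (level (x t) r).card = 2 * Sa := by
  induction t with
  | zero => simpa using hx.init_small 1 le_rfl (by omega)
  | succ t ih =>
    have hl := hx.level_subset_moves hr hd ih
    have heq : level (x (t + 1)) r =
        moves (x t) (x (t + 1)) ((0 : ℕ) * r) (((0 : ℕ) + 1) * r) ∪
        moves (x t) (x (t + 1)) (((1 : ℕ) + 1) * r) ((1 : ℕ) * r) := by
      ext i
      rw [mem_level, Finset.mem_union]
      constructor
      · intro hi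
        rcases hx.unchanged t i with h | ⟨j, -, h | h⟩
        · have := hl (mem_level.2 (h.symm.trans hi))
          rw [Finset.mem_union, mem_moves, mem_moves, hi] at this
          rcases this with this | this
          · have := this.2
            simp at this
            exact absurd this hr.ne'
          · have := this.2
            simp only [Nat.cast_one] at this
            linarith
        · have h2 := (mem_moves.1 h).2
          rw [hi] at h2
          have h3 : (1 : ℝ) * r = ((j : ℝ) + 1) * r := by rw [← h2, one_mul]
          have h4 := mul_right_cancel₀ hr.ne' h3
          have h5 : (j : ℝ) = 0 := by linarith
          have : j = 0 := by exact_mod_cast h5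
          rw [this] at h
          exact Or.inl h
        · have h2 := (mem_moves.1 h).2
          rw [hi] at h2
          have h3 : (1 : ℝ) * r = (j : ℝ) * r := by rw [← h2, one_mul]
          have h4 := mul_right_cancel₀ hr.ne' h3
          have : j = 1 := by exact_mod_cast h4.symm
          rw [this] at h
          exact Or.inr h
      · rintro (h | h)
        · simpa using (mem_moves.1 h).2
        · simpa using (mem_moves.1 h).2
    rw [heq, Finset.card_union_of_disjoint, hx.increase t 0 (by omega),
      hx.decrease t 1 (by omega)]
    · omega
    · refine Finset.disjoint_left.2 fun i hi hi' => ?_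
      rw [mem_moves] at hi hi'
      have h := hi.1.symm.trans hi'.1
      simp only [Nat.cast_zero, Nat.cast_one, zero_mul] at h
      linarith

/-- The elements of a support at time `t + 1` missed by a subset of the support at time `t` which
contains all large elements are either added or have grown to magnitude `2 r`. -/
theorem SignalModel.supp_succ_sdiff_subset (hx : SignalModel x S0 Sa d r) (hr : 0 < r)
    (hd : 2 ≤ d) {t : ℕ} {T : Finset (Fin m)} (hT : supp (x t) \ T ⊆ level (x t) r) :
    supp (x (t + 1)) \ T ⊆ moves (x t) (x (t + 1)) ((0 : ℕ) * r) (((0 : ℕ) + 1) * r) ∪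
      moves (x t) (x (t + 1)) ((1 : ℕ) * r) (((1 : ℕ) + 1) * r) := by
  intro i hi
  rw [Finset.mem_sdiff] at hi
  rw [Finset.mem_union]
  by_cases hit : i ∈ supp (x t)
  · have h := hx.level_subset_moves hr hd (hx.card_level hr hd t)
      (hT (Finset.mem_sdiff.2 ⟨hit, hi.2⟩))
    rw [Finset.mem_union] at h
    refine Or.inr (h.resolve_left fun h => ?_)
    have h2 := (mem_moves.1 h).2
    simp only [Nat.cast_zero, zero_mul, abs_eq_zero] at h2
    exact mem_supp.1 hi.1 h2
  · exact Or.inl (hx.supp_succ_sdiff_supp hr t (Finset.mem_sdiff.2 ⟨hi.1, hit⟩))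

end

/-! ## One step of the algorithm -/

/-- The error of a least squares estimate whose support misses only small entries. -/
theorem IsLSEstimate.error_le {n m : ℕ} {A : Matrix (Fin n) (Fin m) ℝ}
    {T : Finset (Fin m)} {w : Fin n → ℝ} {x z : Fin m → ℝ} {ε r : ℝ} (hr : 0 ≤ r)
    (hw : l2norm w ≤ ε) (hz : IsLSEstimate A T (A *ᵥ x + w) z) {a b : ℕ} (ha : T.card ≤ a)
    (hb : (supp x \ T).card ≤ b) (hδ : ric A a < 1 / 2) (hX : ∀ i ∈ supp x \ T, |x i| ≤ r) :
    l2norm (x - z) ≤ √2 * ε + (2 * roc A a b + 1) * √b * r := by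
  have hε : 0 ≤ ε := (l2norm_nonneg _).trans hw
  have hθ := roc_nonneg A a b
  have h1 := l2norm_restrictTo_le hr hb hX
  have h2 : l2norm (restrictTo T (x - z)) ≤ √2 * ε + 2 * (roc A a b * (√b * r)) := by
    rcases hz.error_on_support hw ha hb hδ h1 with h | h
    · rw [h, l2norm_zero]; positivity
    · exact h.le
  have h3 : restrictTo Tᶜ (x - z) = restrictTo (supp x \ T) x := by
    funext i
    by_cases hi : i ∈ T
    · simp [restrictTo, hi]
    · by_cases hxi : x i = 0
      · simp [restrictTo, hi, hxi, hz.2 i hi]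
      · simp [restrictTo, hi, mem_supp, hxi, hz.2 i hi]
  have h4 := l2norm_add_le (restrictTo T (x - z)) (restrictTo Tᶜ (x - z))
  rw [restrictTo_add_compl, h3] at h4
  linarith

/-- The addition step detects the entries that exceed the threshold by more than the error. -/
theorem IsAddLSDel.mem_Tadd {n m : ℕ} {A : Matrix (Fin n) (Fin m) ℝ} {αadd αdel : ℝ}
    {y : Fin n → ℝ} {s : LSCSState m} (hs : IsAddLSDel A αadd αdel y s) {x : Fin m → ℝ} {E : ℝ}
    (hE : l2norm (x - s.xCSres) ≤ E) {i : Fin m} (hi : i ∈ s.T ∨ αadd + E < |x i|) :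
    i ∈ s.Tadd := by
  rw [hs.add]
  by_cases hiT : i ∈ s.T
  · exact Finset.mem_union_left _ hiT
  · refine Finset.mem_union_right _ (Finset.mem_filter.2 ⟨Finset.mem_univ i, hiT, ?_⟩)
    have h1 := hi.resolve_left hiT
    have h2 := (abs_apply_le_l2norm (x - s.xCSres) i).trans hE
    have h3 := abs_sub_abs_le_abs_sub (x i) (s.xCSres i)
    rw [Pi.sub_apply] at h2
    linarith

/-- The deletion step deletes all zero entries and no entry that exceeds twice the threshold. -/
theorem IsAddLSDel.mem_Tfin {n m : ℕ} {A : Matrix (Fin n) (Fin m) ℝ} {αadd αdel : ℝ}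
    {y : Fin n → ℝ} {s : LSCSState m} (hs : IsAddLSDel A αadd αdel y s) {x : Fin m → ℝ}
    (hE : l2norm (restrictTo s.Tadd (x - s.xadd)) < αdel) :
    (∀ i ∈ s.Tfin, i ∈ supp x) ∧ ∀ i ∈ s.Tadd, 2 * αdel ≤ |x i| → i ∈ s.Tfin := by
  have h : ∀ i ∈ s.Tadd, |x i - s.xadd i| < αdel := fun i hi => by
    have := (abs_apply_le_l2norm (restrictTo s.Tadd (x - s.xadd)) i).trans_lt hE
    rwa [restrictTo_of_mem _ hi, Pi.sub_apply] at this
  rw [hs.del]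
  constructor
  · intro i hi
    simp only [Finset.mem_sdiff, Finset.mem_filter, not_and, not_le] at hi
    rw [mem_supp]
    intro h0
    have h1 := h i hi.1
    rw [h0, zero_sub, abs_neg] at h1
    exact absurd h1 (hi.2 hi.1).le.not_gt
  · intro i hi hxi
    simp only [Finset.mem_sdiff, Finset.mem_filter, not_and, not_le]
    refine ⟨hi, fun _ => ?_⟩
    have h1 := h i hi
    have h2 := abs_sub_abs_le_abs_sub (x i) (s.xadd i)
    linarith

/-- The detection step at one time: `G̃₁ ≤ r` makes the entries of magnitude `2 r` detectable. -/
theorem add_error_lt_two_mul {n m : ℕ} {A : Matrix (Fin n) (Fin m) ℝ} {S0 Sa : ℕ} (hSa : 1 ≤ Sa)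
    {r ε αadd : ℝ} (hr : 0 < r)
    (hθC : roc A S0 (2 * Sa) * constC'' A S0 (2 * Sa) < 1 / ((2 + √2) * √(Sa : ℝ)))
    (hpos : 0 < roc A S0 (2 * Sa) * constC'' A S0 (2 * Sa))
    (hrate : rateG1 A S0 Sa hSa ε αadd ≤ r) :
    αadd + (constC' A S0 (2 * Sa) * ε + roc A S0 (2 * Sa) * constC'' A S0 (2 * Sa) * (2 * r)) <
      2 * r := by
  have h1 : (1 : ℝ) ≤ √Sa := Real.one_le_sqrt.2 (by exact_mod_cast hSa)
  have h2 : 0 < √2 := Real.sqrt_pos.2 (by norm_num)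
  have h3 : (αadd + constC' A S0 (2 * Sa) * ε) /
      (2 - (2 + √2) * roc A S0 (2 * Sa) * √(Sa : ℝ) * constC'' A S0 (2 * Sa)) ≤ r :=
    (Finset.le_sup' (fun k => (αadd + constC' A S0 k * ε) /
      (2 - (2 + √2) * roc A S0 k * √(Sa : ℝ) * constC'' A S0 k))
      (Finset.mem_Icc.2 ⟨by omega, le_rfl⟩)).trans hrate
  set c := roc A S0 (2 * Sa) * constC'' A S0 (2 * Sa)
  have e : (2 + √2) * roc A S0 (2 * Sa) * √(Sa : ℝ) * constC'' A S0 (2 * Sa) =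
      c * ((2 + √2) * √Sa) := by ring
  rw [lt_div_iff₀ (by positivity)] at hθC
  rw [e, div_le_iff₀ (by linarith)] at h3
  -- The rate condition leaves room for `(2 + √2) √Sa * c * r`, while detection needs only `2 * c *
  -- r`; the gap is strict because `c > 0`.
  have h4 : 2 < (2 + √2) * √(Sa : ℝ) := by nlinarith
  have h5 := mul_lt_mul_of_pos_left h4 (mul_pos hpos hr)
  linarith

section
variable {n m : ℕ} {A : Matrix (Fin n) (Fin m) ℝ} {S0 Sa d : ℕ} {r ε αadd αdel : ℝ}
  {x : ℕ → Fin m → ℝ}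

/-- The detection and deletion properties of one step `t → t + 1`, together with the error of the
CS-residual step. -/
theorem SignalModel.lscs_step (hnm : n < m) (hSa : 1 ≤ Sa) (hd : 2 ≤ d) (hr : 0 < r)
    (hx : SignalModel x S0 Sa d r) (hS0 : 1 ≤ S0)
    (hdel : αdel = √2 * ε + 2 * √(Sa : ℝ) * roc A (S0 + 2 * Sa) Sa * r)
    (hδ₁ : ric A (4 * Sa) < (√2 - 1) / 2) (hδ₂ : ric A (S0 + 2 * Sa) < 1 / 2)
    (hθ₁ : roc A S0 (2 * Sa) * constC'' A S0 (2 * Sa) < 1 / ((2 + √2) * √(Sa : ℝ)))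
    (hθ₂ : roc A (S0 + 2 * Sa) Sa < 1 / 2 * √(1 / (4 * (Sa : ℝ))))
    (hG₁ : rateG1 A S0 Sa hSa ε αadd ≤ r) (hG₂ : rateG2 A S0 Sa ε ≤ r)
    {t : ℕ} {w : Fin n → ℝ} (hw : l2norm w ≤ ε) {s : LSCSState m}
    (hcs : IsCSResidual A ε s.T (A *ᵥ x (t + 1) + w) s.xCSres)
    (hs : IsAddLSDel A αadd αdel (A *ᵥ x (t + 1) + w) s)
    (hadd : ((s.Tadd \ s.T) \ supp (x (t + 1))).card ≤ Sa)
    (hT : s.T ⊆ supp (x t)) (hmiss : supp (x t) \ s.T ⊆ level (x t) r) :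
    (s.T \ supp (x (t + 1))).card ≤ Sa ∧ (supp (x (t + 1)) \ s.T).card ≤ 2 * Sa ∧
    s.Tadd.card ≤ S0 + 2 * Sa ∧ (s.Tadd \ supp (x (t + 1))).card ≤ 2 * Sa ∧
    (supp (x (t + 1)) \ s.Tadd).card ≤ Sa ∧
    l2norm (x (t + 1) - s.xCSres) ≤ constC' A S0 (2 * Sa) * ε +
      (roc A S0 (2 * Sa) * constC'' A S0 (2 * Sa) + 1) * √(2 * (Sa : ℝ)) * r ∧
    s.Tfin ⊆ supp (x (t + 1)) ∧ supp (x (t + 1)) \ s.Tfin ⊆ level (x (t + 1)) r := by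
  have hε : 0 ≤ ε := (l2norm_nonneg _).trans hw
  have hs2 : √2 * √2 = 2 := Real.mul_self_sqrt (by norm_num)
  have hs1 : (1 : ℝ) ≤ √2 := Real.one_le_sqrt.2 (by norm_num)
  -- `(√2 - 1) / 2` is `1 / (2 (√2 + 1))`, so the left side is even below `1 / 2`.
  have hδ2k : (√2 + 1) * ric A (2 * (2 * Sa)) < 1 := by
    rw [show 2 * (2 * Sa) = 4 * Sa by ring]
    nlinarith
  have hδS0 : ric A S0 < 1 / 2 := (ric_mono A (by omega)).trans_lt hδ₂
  have hTcard : s.T.card ≤ S0 :=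
    (Finset.card_le_card hT).trans (hx.card_supp hr (by omega) t).le
  have hsub := hx.supp_succ_sdiff_subset hr hd hmiss
  have c1 : (s.T \ supp (x (t + 1))).card ≤ Sa := by
    refine (Finset.card_le_card ?_).trans (hx.decrease t 0 (by omega)).le
    exact (Finset.sdiff_subset_sdiff hT subset_rfl).trans (hx.supp_sdiff_supp_succ hr t)
  have c2 : (supp (x (t + 1)) \ s.T).card ≤ 2 * Sa := by
    refine ((Finset.card_le_card hsub).trans (Finset.card_union_le _ _)).trans ?_
    rw [hx.increase t 0 (by omega), hx.increase t 1 (by omega)]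
    omega
  have hval : ∀ i ∈ supp (x (t + 1)) \ s.T, |x (t + 1) i| ≤ 2 * r := by
    intro i hi
    rcases Finset.mem_union.1 (hsub hi) with h | h <;> rw [(mem_moves.1 h).2] <;>
      simp only [Nat.cast_zero, Nat.cast_one] <;> linarith
  -- the CS-residual step
  have hX := l2norm_restrictTo_le (by linarith : 0 ≤ 2 * r) c2 hval
  have hcsE := hcs.error_le hw hTcard (by omega) c2 hδS0 hδ2k hX
  have hsqrt : 0 < √((2 * Sa : ℕ) : ℝ) := Real.sqrt_pos.2 (by exact_mod_cast (by omega))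
  -- For `k = 2 * Sa` and `X = √k * (2 * r)` the quotient `X / √k` is `2 * r`.
  rw [mul_div_cancel_left₀ _ hsqrt.ne'] at hcsE
  have hpos : 0 < roc A S0 (2 * Sa) * constC'' A S0 (2 * Sa) := by
    refine mul_pos (roc_pos hnm A hS0 (by omega) (by omega) (hδS0.trans (by norm_num))) ?_
    have := constC2_pos A hδ2k
    have : 0 < √(S0 : ℝ) := Real.sqrt_pos.2 (by exact_mod_cast hS0)
    unfold constC''
    positivity
  have hdetect := add_error_lt_two_mul hSa hr hθ₁ hpos hG₁
  have hlarge : ∀ i ∈ supp (x (t + 1)), i ∉ s.Tadd → |x (t + 1) i| = r := by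
    intro i hi hiT
    refine (hx.eq_or_two_mul_le hr (by omega) hi).resolve_right fun h => hiT ?_
    exact hs.mem_Tadd hcsE (Or.inr (hdetect.trans_le h))
  have hTTadd : s.T ⊆ s.Tadd := fun i hi => hs.mem_Tadd hcsE (Or.inl hi)
  -- the support after the addition step
  have c4 : (s.Tadd \ supp (x (t + 1))).card ≤ 2 * Sa := by
    have : s.Tadd \ supp (x (t + 1)) ⊆
        s.T \ supp (x (t + 1)) ∪ (s.Tadd \ s.T) \ supp (x (t + 1)) := by
      intro i hi
      simp only [Finset.mem_union, Finset.mem_sdiff] at hi ⊢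
      tauto
    have := (Finset.card_le_card this).trans (Finset.card_union_le _ _)
    omega
  have c3 : s.Tadd.card ≤ S0 + 2 * Sa := by
    have h1 := Finset.card_sdiff_add_card_inter s.Tadd (supp (x (t + 1)))
    have h2 := Finset.card_le_card
      (Finset.inter_subset_right (s₁ := s.Tadd) (s₂ := supp (x (t + 1))))
    rw [hx.card_supp hr (by omega)] at h2
    omega
  -- The entries that grew to `2 * r` are detected, so only the `Sa` additions can still be missing.
  have c5 : (supp (x (t + 1)) \ s.Tadd).card ≤ Sa := by
    refine (Finset.card_le_card ?_).trans (hx.increase t 0 (by omega)).le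
    intro i hi
    have hi' := Finset.mem_sdiff.1 hi
    have h := hsub (Finset.mem_sdiff.2 ⟨hi'.1, fun h => hi'.2 (hTTadd h)⟩)
    refine (Finset.mem_union.1 h).resolve_right fun h => ?_
    have h1 := (mem_moves.1 h).2
    rw [hlarge i hi'.1 hi'.2, Nat.cast_one] at h1
    linarith
  refine ⟨c1, c2, c3, c4, c5, hcsE.trans ?_, ?_⟩
  -- The error obtained has `2 * c * r` in place of `(c + 1) √(2 Sa) r`; since `c ≤ 1`, it is the
  -- smaller one.
  · have h1 : roc A S0 (2 * Sa) * constC'' A S0 (2 * Sa) ≤ 1 := by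
      refine hθ₁.le.trans ((div_le_one (by positivity)).2 ?_)
      have : (1 : ℝ) ≤ √Sa := Real.one_le_sqrt.2 (by exact_mod_cast hSa)
      nlinarith
    set c := roc A S0 (2 * Sa) * constC'' A S0 (2 * Sa)
    have h2 : √2 ≤ √(2 * (Sa : ℝ)) := by
      refine Real.sqrt_le_sqrt ?_
      have : (1 : ℝ) ≤ Sa := by exact_mod_cast hSa
      linarith
    have h3 : 2 * c ≤ (c + 1) * √2 := by nlinarith
    have h4 : 2 * c ≤ (c + 1) * √(2 * (Sa : ℝ)) :=
      h3.trans (mul_le_mul_of_nonneg_left h2 (by linarith))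
    have := mul_le_mul_of_nonneg_right h4 hr.le
    linarith
  -- the deletion step
  · have hθ : 0 < roc A (S0 + 2 * Sa) Sa :=
      roc_pos hnm A (by omega) hSa (by omega : 1 ≤ S0) (hδS0.trans (by norm_num))
    have hSapos : 0 < √(Sa : ℝ) := Real.sqrt_pos.2 (by exact_mod_cast hSa)
    have hαpos : 0 < αdel := by rw [hdel]; positivity
    have hE : l2norm (restrictTo s.Tadd (x (t + 1) - s.xadd)) < αdel := by
      have hX' := l2norm_restrictTo_le hr.le c5 fun i hi =>
        (hlarge i (Finset.mem_sdiff.1 hi).1 (Finset.mem_sdiff.1 hi).2).le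
      rcases hs.add_ls.error_on_support hw c3 c5 hδ₂ hX' with h | h
      · rwa [h, l2norm_zero]
      · refine h.trans_eq ?_
        rw [hdel]; ring
    -- The bound `hθ₂` makes the denominator of `rateG2` positive; once it is cleared, `rateG2 ≤ r`
    -- reads `αdel ≤ r`.
    have hαr : αdel ≤ r := by
      have h4 : √(4 * (Sa : ℝ)) = 2 * √Sa := by
        rw [Real.sqrt_mul (by norm_num), show (4 : ℝ) = 2 ^ 2 by norm_num,
          Real.sqrt_sq (by norm_num)]
      unfold rateG2 at hG₂
      rw [Real.sqrt_div zero_le_one, Real.sqrt_one, h4] at hθ₂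
      rw [h4] at hG₂
      have h5 : roc A (S0 + 2 * Sa) Sa * (2 * √Sa) < 1 / 2 := by
        have := mul_lt_mul_of_pos_right hθ₂ (by positivity : 0 < 2 * √(Sa : ℝ))
        rwa [mul_assoc, one_div_mul_cancel (by positivity), mul_one] at this
      rw [div_le_iff₀ (by linarith)] at hG₂
      rw [hdel]
      linarith
    obtain ⟨h1, h2⟩ := hs.mem_Tfin hE
    refine ⟨h1, fun i hi => ?_⟩
    rw [Finset.mem_sdiff] at hi
    rw [mem_level]
    by_cases hiT : i ∈ s.Tadd
    · exact (hx.eq_or_two_mul_le hr (by omega) hi.1).resolve_right fun h =>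
        hi.2 (h2 i hiT (by linarith))
    · exact hlarge i hi.1 hiT

end

/-! ### Induction over time -/

theorem theorem3 {n₀ n m : ℕ} (hnm : n < m)
    (A₀ : Matrix (Fin n₀) (Fin m) ℝ) (A : Matrix (Fin n) (Fin m) ℝ)
    (S0 Sa d : ℕ) (hSa : 1 ≤ Sa) (hd : 2 ≤ d)
    (r ε αadd αdel : ℝ) (hr : 0 < r)
    -- the signals follow the signal model
    (x : ℕ → Fin m → ℝ) (hx : SignalModel x S0 Sa d r)
    -- the observations, with noise bounded by `ε`
    (w₀ y₀ : Fin n₀ → ℝ) (hw₀ : l2norm w₀ ≤ ε) (hy₀ : y₀ = A₀ *ᵥ x 0 + w₀)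
    (w y : ℕ → Fin n → ℝ) (hw : ∀ t, 1 ≤ t → l2norm (w t) ≤ ε)
    (hy : ∀ t, 1 ≤ t → y t = A *ᵥ x t + w t)
    -- a run of the algorithm
    (s : ℕ → LSCSState m) (hs : IsLSCSRun A₀ A ε αadd αdel y₀ y s)
    -- thresholds: at most `Sa` false additions at each time, and the value of `αdel`
    (hadd : ∀ t, (((s t).Tadd \ (s t).T) \ supp (x t)).card ≤ Sa)
    (hdel : αdel = √2 * ε + 2 * √(Sa : ℝ) * roc A (S0 + 2 * Sa) Sa * r)
    -- support size and support change rate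
    (hδ₁ : ric A (4 * Sa) < (√2 - 1) / 2)
    (hδ₂ : ric A (S0 + 2 * Sa) < 1 / 2)
    (hθ₁ : roc A S0 (2 * Sa) * constC'' A S0 (2 * Sa) < 1 / ((2 + √2) * √(Sa : ℝ)))
    (hθ₂ : roc A (S0 + 2 * Sa) Sa < 1 / 2 * √(1 / (4 * (Sa : ℝ))))
    -- rate of increase
    (hrate : max (rateG1 A S0 Sa hSa ε αadd) (rateG2 A S0 Sa ε) ≤ r)
    -- initial time
    (hinit_small : supp (x 0) \ (s 0).Tfin ⊆ small (x 0) (2 * r))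
    (hinit_miss : (supp (x 0) \ (s 0).Tfin).card ≤ 2 * Sa)
    (hinit_extra : ((s 0).Tfin \ supp (x 0)).card = 0)
    (hinit_card : (s 0).Tfin.card ≤ S0) :
    -- final support estimate
    (∀ t, (s t).Tfin.card ≤ S0 ∧ ((s t).Tfin \ supp (x t)).card = 0 ∧
      (supp (x t) \ (s t).Tfin).card ≤ 2 * Sa) ∧
    -- initial support estimate
    (∀ t, (s t).T.card ≤ S0 ∧ ((s t).T \ supp (x t)).card ≤ Sa ∧
      (1 ≤ t → (supp (x t) \ (s t).T).card ≤ 2 * Sa)) ∧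
    -- support estimate after the addition step
    (∀ t, (s t).Tadd.card ≤ S0 + 2 * Sa ∧ ((s t).Tadd \ supp (x t)).card ≤ 2 * Sa ∧
      (1 ≤ t → (supp (x t) \ (s t).Tadd).card ≤ Sa)) ∧
    -- error of the final estimate
    (∀ t, 1 ≤ t → l2norm (x t - (s t).xhat) ≤
      √2 * ε + (2 * roc A S0 (2 * Sa) + 1) * √(2 * (Sa : ℝ)) * r) ∧
    (ric A₀ S0 < 1 / 2 → l2norm (x 0 - (s 0).xhat) ≤
      √2 * ε + (2 * roc A₀ S0 (2 * Sa) + 1) * √(2 * (Sa : ℝ)) * r) ∧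
    -- error of the CS-residual step
    (∀ t, 1 ≤ t → l2norm (x t - (s t).xCSres) ≤
      maxCard Sa hSa fun k =>
        constC' A S0 k * ε + (roc A S0 k * constC'' A S0 k + 1) * √(2 * (Sa : ℝ)) * r) := by
  have hS0 : 1 ≤ S0 := by
    have h1 := hx.init_large
    have h2 : 1 * 1 ≤ (2 * d - 2) * Sa := Nat.mul_le_mul (by omega) hSa
    omega
  have hG₁ := (le_max_left _ _).trans hrate
  have hG₂ := (le_max_right _ _).trans hrate
  -- A nonzero magnitude below `2 * r` equals `r`, so the initial assumption is the invariant at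
  -- time `0`.
  have hinv0 : (s 0).Tfin ⊆ supp (x 0) ∧ supp (x 0) \ (s 0).Tfin ⊆ level (x 0) r := by
    refine ⟨Finset.sdiff_eq_empty_iff_subset.1 (Finset.card_eq_zero.1 hinit_extra), fun i hi => ?_⟩
    have h := hinit_small hi
    simp only [small, Finset.mem_filter, Finset.mem_univ, true_and] at h
    exact mem_level.2 ((hx.eq_or_two_mul_le hr (by omega) (Finset.mem_sdiff.1 hi).1).resolve_right
      (not_le.2 h.2))
  have hstep := fun (t : ℕ) (hinv : (s t).Tfin ⊆ supp (x t) ∧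
      supp (x t) \ (s t).Tfin ⊆ level (x t) r) =>
    hx.lscs_step hnm hSa hd hr hS0 hdel hδ₁ hδ₂ hθ₁ hθ₂ hG₁ hG₂ (hw (t + 1) (by omega))
      (s := s (t + 1)) (by rw [← hy (t + 1) (by omega)]; exact hs.step_csres t)
      (by rw [← hy (t + 1) (by omega)]; exact hs.step_addLSDel t) (hadd (t + 1))
      (by rw [hs.step_T]; exact hinv.1) (by rw [hs.step_T]; exact hinv.2)
  have hinv : ∀ t, (s t).Tfin ⊆ supp (x t) ∧ supp (x t) \ (s t).Tfin ⊆ level (x t) r := by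
    intro t
    induction t with
    | zero => exact hinv0
    | succ t ih => exact (hstep t ih).2.2.2.2.2.2
  have hsupp := hx.card_supp hr (by omega : 1 ≤ d)
  have hfin : ∀ t, (s t).Tfin.card ≤ S0 ∧ ((s t).Tfin \ supp (x t)).card = 0 ∧
      (supp (x t) \ (s t).Tfin).card ≤ 2 * Sa := fun t =>
    ⟨(Finset.card_le_card (hinv t).1).trans (hsupp t).le,
      by rw [Finset.sdiff_eq_empty_iff_subset.2 (hinv t).1, Finset.card_empty],
      (Finset.card_le_card (hinv t).2).trans (hx.card_level hr hd t).le⟩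
  have hmiss : ∀ t, ∀ i ∈ supp (x t) \ (s t).Tfin, |x t i| ≤ r := fun t i hi =>
    (mem_level.1 ((hinv t).2 hi)).le
  refine ⟨hfin, ?_, ?_, ?_, ?_, ?_⟩
  · rintro (_ | t)
    · rw [hs.init_T]; simp
    · obtain ⟨h1, h2, -⟩ := hstep t (hinv t)
      exact ⟨by rw [hs.step_T]; exact (hfin t).1, h1, fun _ => h2⟩
  · rintro (_ | t)
    · have h1 := hadd 0
      rw [hs.init_T, Finset.sdiff_empty] at h1
      have h2 := Finset.card_sdiff_add_card_inter (s 0).Tadd (supp (x 0))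
      have h3 := Finset.card_le_card
        (Finset.inter_subset_right (s₁ := (s 0).Tadd) (s₂ := supp (x 0)))
      rw [hsupp 0] at h3
      exact ⟨by omega, by omega, fun h => absurd h (by omega)⟩
    · obtain ⟨-, -, h3, h4, h5, -⟩ := hstep t (hinv t)
      exact ⟨h3, h4, fun _ => h5⟩
  · intro t ht
    obtain ⟨t, rfl⟩ : ∃ u, t = u + 1 := ⟨t - 1, by omega⟩
    have h := (hs.step_addLSDel t).del_ls
    rw [hy (t + 1) ht] at h
    have := h.error_le hr.le (hw (t + 1) ht) (hfin _).1 (hfin _).2.2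
      ((ric_mono A (by omega)).trans_lt hδ₂) (hmiss _)
    push_cast at this
    exact this
  · intro hδ₀
    have h := hs.init_addLSDel.del_ls
    rw [hy₀] at h
    have := h.error_le hr.le hw₀ (hfin 0).1 (hfin 0).2.2 hδ₀ (hmiss 0)
    push_cast at this
    exact this
  · intro t ht
    obtain ⟨t, rfl⟩ : ∃ u, t = u + 1 := ⟨t - 1, by omega⟩
    -- The step bounds the error by the term `k = 2 * Sa` of the maximum, whatever the actual number
    -- of missed entries.
    obtain ⟨-, -, -, -, -, h6, -⟩ := hstep t (hinv t)
    exact h6.trans (Finset.le_sup' (fun k => constC' A S0 k * ε +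
      (roc A S0 k * constC'' A S0 k + 1) * √(2 * (Sa : ℝ)) * r)
      (Finset.mem_Icc.2 ⟨by omega, le_rfl⟩))
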